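/- Let $n\ge 1$, let $M\subset\mathbb{R}^n$ be compact and convex, and let $m$ be a probability measure on $\mathbb{R}^n$ that is absolutely continuous with respect to Lebesgue measure and has topological support $M$. For $\varphi:M\to\mathbb{R}$ put $\varphi^{\mathfrak c}(x)=-\inf_{y\in M}\left[\tfrac12|x-y|^2+\varphi(y)\right]$; call $\varphi$ *$d^2/2$-convex* if $\varphi=\psi^{\mathfrak c}$ on $M$ for some $\psi:M\to\mathbb{R}$. For a probability measure $\mu$ on $M$, an *optimal transport map* from $m$ to $\mu$ is a Borel map $g:M\to M$ with $g_*m=\mu$ that minimizes $\int|x-h(x)|^2\,m(dx)$ among all Borel maps $h:M\to M$ with $h_*m=\mu$. A measure $\nu$ is called a *conjugate measure* $\mu^{\mathfrak c}$ of $\mu$ if there is a $d^2/2$-convex $\varphi$ with $(\mathrm{Id}+\nabla\varphi)_*m=\mu$ and $(\mathrm{Id}+\nabla\varphi^{\mathfrak c})_*m=\nu$. Let $I$ be a finite or countably infinite index set, let $z_i\in M$ $(i\in I)$ be pairwise distinct, let $\lambda_i\ge0$ with $\sum_{i\in I}\lambda_i=1$, and put $\mu=\sum_{i\in I}\lambda_i\delta_{z_i}$.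 For numbers $\alpha_i\in\mathbb{R}$ with $\sup_i\alpha_i<\infty$ put $$\varphi_1(x)=\sup_{i\in I}\left[\langle z_i,x\rangle+\alpha_i\right],\qquad A_i=\{x\in\mathbb{R}^n:\varphi_1(x)=\langle z_i,x\rangle+\alpha_i\},\qquad U_i=\text{the interior of } M\cap A_i .$$ Then an optimal transport map from $m$ to $\mu$ exists, a conjugate measure $\mu^{\mathfrak c}$ exists, and there are numbers $\alpha_i$ with $\sup_i\alpha_i<\infty$ such that $m(A_i)=\lambda_i$ for all $i$. Moreover, for every such choice of the $\alpha_i$: (i) The sets $U_i\subset M$ are open, convex and pairwise disjoint, and $m(U_i)=\lambda_i$. (ii) The function $\varphi_1-\tfrac12|\cdot|^2$ is $d^2/2$-convex on $M$, and $\nabla\varphi_1=z_i$ everywhere on $U_i$. Every optimal transport map $g$ from $m$ to $\mu$ satisfies $g=\nabla\varphi_1$ $m$-a.e.; in particular $g=z_i$ $m$-a.e. on $U_i$ for each $i$. (iii) The set $M\setminus\bigcup_iU_i$ is compact and $m$-null, and every conjugate measure $\mu^{\mathfrak c}$ of $\mu$ is a probability measure with $\mu^{\mathfrak c}\left(\mathbb{R}^n\setminus(M\setminus\bigcup_iU_i)\right)=0$.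 (iv) If $I$ is finite, then each $A_i$ is a (possibly unbounded) convex polytope, i.e. an intersection of finitely many closed half-spaces. The $A_i$ form a Laguerre tessellation of $\mathbb{R}^n$ with sites $z_i$: there are $r_i\ge0$ with $A_i=\{x:|x-z_i|^2-r_i^2\le|x-z_j|^2-r_j^2\text{ for all }j\in I\}$, the $A_i$ cover $\mathbb{R}^n$ and have pairwise disjoint interiors, and $A_i$ has non-empty interior whenever $\lambda_i>0$. Finally, $M\setminus\bigcup_iU_i$ has finite $(n-1)$-dimensional Hausdorff measure. -/

import Mathlib

open MeasureTheory
open scoped ENNReal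

noncomputable section

namespace ConjugationMap

variable {E : Type*} [NormedAddCommGroup E] [InnerProductSpace ℝ E]

/-- The conjugate (generalized Legendre transform) of `φ` over `M`:
`φᶜ(x) = - inf_{y ∈ M} [d(x,y)²/2 + φ(y)]`. Only the values of `φ` on `M` enter. -/
def conj (M : Set E) (φ : E → ℝ) (x : E) : ℝ :=
  -sInf ((fun y => dist x y ^ 2 / 2 + φ y) '' M)

/-- `φ` is `d²/2`-convex on `M`: for some real function `ψ` on `M`,
`φ(x) = - inf_{y ∈ M} [d(x,y)²/2 + ψ(y)]` for all `x ∈ M` (in particular the infimum is finite).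
Values of `φ` and `ψ` off `M` are irrelevant. -/
def IsDSqConvex (M : Set E) (φ : E → ℝ) : Prop :=
  ∃ ψ : E → ℝ, ∀ x ∈ M, IsGLB ((fun y => dist x y ^ 2 / 2 + ψ y) '' M) (-φ x)

/-- The map `exp(∇φ)`, which is `x ↦ x + ∇φ(x)` in a Euclidean space. It is used only up to null
sets of a measure that charges neither the boundary of `M` nor the points at which a
`d²/2`-convex function is not differentiable. -/
def expGrad [CompleteSpace E] (φ : E → ℝ) (x : E) : E :=
  x + gradient φ x

/-- `g` is an optimal transport map from `m` to `μ`: a Borel map `M → M` with `g_* m = μ` which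
minimizes `∫ d(x, h(x))² m(dx)` among all Borel maps `h : M → M` with `h_* m = μ`. -/
structure IsOptimalTransportMap [MeasurableSpace E] (M : Set E) (m μ : Measure E) (g : E → E) :
    Prop where
  measurable : Measurable g
  mapsTo : Set.MapsTo g M M
  map_eq : m.map g = μ
  optimal : ∀ h : E → E, Measurable h → Set.MapsTo h M M → m.map h = μ →
    ∫ x, dist x (g x) ^ 2 ∂m ≤ ∫ x, dist x (h x) ^ 2 ∂m

/-- `ν` is the conjugate measure `μᶜ` of `μ` with respect to the reference measure `m` on `M`:
`μ = exp(∇φ)_* m` and `ν = exp(∇φᶜ)_* m` for a `d²/2`-convex function `φ` on `M`. -/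
def IsConjugateMeasure [CompleteSpace E] [MeasurableSpace E] (M : Set E) (m μ ν : Measure E) :
    Prop :=
  ∃ φ : E → ℝ, IsDSqConvex M φ ∧ m.map (expGrad φ) = μ ∧ m.map (expGrad (conj M φ)) = ν

/-- The discrete measure `∑ i, w i • δ_{z i}`. -/
def discreteMeasure [MeasurableSpace E] {ι : Type*} (z : ι → E) (w : ι → ℝ≥0∞) : Measure E :=
  Measure.sum fun i => w i • Measure.dirac (z i)

/-- `φ₁(x) = sup_i [⟨z i, x⟩ + α i]`. -/
def supAffine {ι : Type*} (z : ι → E) (α : ι → ℝ) (x : E) : ℝ :=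
  ⨆ i, (inner ℝ (z i) x + α i)

/-- `A i = {x : φ₁(x) = ⟨z i, x⟩ + α i}`. -/
def contactSet {ι : Type*} (z : ι → E) (α : ι → ℝ) (i : ι) : Set E :=
  {x | supAffine z α x = inner ℝ (z i) x + α i}

/-- `U i`, the interior of `M ∩ A i`. -/
def openCell {ι : Type*} (M : Set E) (z : ι → E) (α : ι → ℝ) (i : ι) : Set E :=
  interior (M ∩ contactSet z α i)

/-- A (possibly unbounded) convex polytope: an intersection of finitely many closed
half-spaces. -/
def IsConvexPolytope (A : Set E) : Prop :=
  ∃ s : Finset (E × ℝ), (∀ p ∈ s, p.1 ≠ 0) ∧ A = {x | ∀ p ∈ s, inner ℝ p.1 x ≤ p.2}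

/-- The sets `A i` form the Laguerre tessellation of the space with sites `z i`, for suitable
radii `r i ≥ 0`: `A i` consists of the points whose power distance `‖x - z j‖² - (r j)²` is
minimal for `j = i`; the cells cover the space and have disjoint interiors. -/
structure IsLaguerreTessellation {ι : Type*} (z : ι → E) (A : ι → Set E) : Prop where
  cells : ∃ r : ι → ℝ, (∀ i, 0 ≤ r i) ∧
    ∀ i, A i = {x | ∀ j, ‖x - z i‖ ^ 2 - r i ^ 2 ≤ ‖x - z j‖ ^ 2 - r j ^ 2}
  cover : ⋃ i, A i = Set.univ
  disjoint : Pairwise fun i j => Disjoint (interior (A i)) (interior (A j))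

end ConjugationMap

end

/-! The whole statement is convex duality. Expanding the square, minimizing the cost over maps `g`
with law μ amounts to maximizing ∫⟨g(x), x⟩ dm. Now φ₁(x) ≥ ⟨z_i, x⟩ + α_i, with equality exactly on
A_i, and the integral of α(g(x)) depends only on μ. So ∫φ₁ dm − ∫α dμ bounds the correlation, and
equality forces g(x) = z_j with x ∈ A_j for almost every x (`integral_inner_le`). Inside U_i no
affine function of another slope can touch φ₁, so g = z_i there almost everywhere.

Suitable α minimize the dual functional ∫φ₁ dm − ∑ λ_i α_i. A minimizer exists by Arzelà–Ascoli,
since weights may be replaced by restrictions of uniformly Lipschitz functions. Raising a single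
weight gives m(A_i) ≥ λ_i, and the total mass 1 turns this into equality (`exists_hasCellMasses`).

For a conjugate measure, f = φ + |·|²/2 and c = φᶜ + |·|²/2 are Legendre transforms of each other on
M. As ∇f pushes m to μ and attains the dual bound, ∇f = z_i almost everywhere on U_i. If y = ∇c(x)
lay in U_i, then x would be a subgradient of f at y, which forces x = z_i; the sites form a
countable null set (`ae_conj_mem`).

For finite `ι` the exceptional set lies in the boundaries of the compact convex sets M ∩ A_i, each
contained in the nearest-point projection of the surface of a large cube. -/

namespace ConjugationMap

open Set Filter Topology

set_option linter.unusedSectionVars false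

/-! ### Suprema of affine functions and their contact sets. -/

section Affine

variable {E : Type*} [NormedAddCommGroup E] [InnerProductSpace ℝ E] {ι : Type*}
  {z : ι → E} {α : ι → ℝ} {R : ℝ} {M : Set E}

lemma bddAbove_affine (hz : ∀ i, ‖z i‖ ≤ R) (hα : BddAbove (range α)) (x : E) :
    BddAbove (range fun i => inner ℝ (z i) x + α i) := by
  obtain ⟨C, hC⟩ := hα
  refine ⟨R * ‖x‖ + C, ?_⟩
  rintro _ ⟨i, rfl⟩
  have h1 := real_inner_le_norm (z i) x
  have h2 := mul_le_mul_of_nonneg_right (hz i) (norm_nonneg x)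
  have h3 := hC (mem_range_self i)
  dsimp only
  linarith

lemma le_supAffine (hz : ∀ i, ‖z i‖ ≤ R) (hα : BddAbove (range α)) (x : E) (i : ι) :
    inner ℝ (z i) x + α i ≤ supAffine z α x :=
  le_ciSup (bddAbove_affine hz hα x) i

lemma supAffine_le [Nonempty ι] {x : E} {c : ℝ} (h : ∀ i, inner ℝ (z i) x + α i ≤ c) :
    supAffine z α x ≤ c :=
  ciSup_le h

lemma mem_contactSet_iff (hz : ∀ i, ‖z i‖ ≤ R) (hα : BddAbove (range α)) {x : E} {i : ι} :
    x ∈ contactSet z α i ↔ ∀ j, inner ℝ (z j) x + α j ≤ inner ℝ (z i) x + α i := by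
  have : Nonempty ι := ⟨i⟩
  constructor
  · intro h j
    rw [← show supAffine z α x = _ from h]
    exact le_supAffine hz hα x j
  · intro h
    exact le_antisymm (supAffine_le h) (le_supAffine hz hα x i)

lemma contactSet_eq_iInter (hz : ∀ i, ‖z i‖ ≤ R) (hα : BddAbove (range α)) (i : ι) :
    contactSet z α i = ⋂ j, {x | inner ℝ (z j - z i) x ≤ α i - α j} := by
  ext x
  rw [mem_contactSet_iff hz hα]
  simp only [mem_iInter, mem_ofPred_eq, inner_sub_left]
  exact forall_congr' fun j => by constructor <;> intro h <;> linarith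

lemma isClosed_contactSet (hz : ∀ i, ‖z i‖ ≤ R) (hα : BddAbove (range α)) (i : ι) :
    IsClosed (contactSet z α i) := by
  rw [contactSet_eq_iInter hz hα]
  exact isClosed_iInter fun j => isClosed_le (by fun_prop) continuous_const

lemma convex_contactSet (hz : ∀ i, ‖z i‖ ≤ R) (hα : BddAbove (range α)) (i : ι) :
    Convex ℝ (contactSet z α i) := by
  rw [contactSet_eq_iInter hz hα]
  exact convex_iInter fun j => convex_halfSpace_le (innerₛₗ ℝ (z j - z i)).isLinear _

lemma supAffine_sub_le [Nonempty ι] (hz : ∀ i, ‖z i‖ ≤ R) (hα : BddAbove (range α)) (x y : E) :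
    supAffine z α x - supAffine z α y ≤ R * ‖x - y‖ := by
  rw [sub_le_iff_le_add]
  refine supAffine_le fun i => ?_
  have h1 := le_supAffine hz hα y i
  have h2 := real_inner_le_norm (z i) (x - y)
  have h3 := mul_le_mul_of_nonneg_right (hz i) (norm_nonneg (x - y))
  rw [inner_sub_right] at h2
  linarith

lemma continuous_supAffine [Nonempty ι] (hz : ∀ i, ‖z i‖ ≤ R) (hα : BddAbove (range α)) :
    Continuous (supAffine z α) :=
  (LipschitzWith.of_le_add_mul' R fun x y => by
    rw [dist_eq_norm]
    linarith [supAffine_sub_le hz hα x y]).continuous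

lemma isOpen_openCell (i : ι) : IsOpen (openCell M z α i) := isOpen_interior

lemma openCell_subset (i : ι) : openCell M z α i ⊆ M :=
  interior_subset.trans inter_subset_left

lemma openCell_subset_contactSet (i : ι) : openCell M z α i ⊆ contactSet z α i :=
  interior_subset.trans inter_subset_right

/-- If `x` lies in an open set and the linear form `⟪u, · - x⟫` is nonpositive there,
then `u = 0`. -/
lemma eq_zero_of_inner_sub_nonpos {U : Set E} (hU : IsOpen U) {x u : E} (hx : x ∈ U)
    (h : ∀ y ∈ U, inner ℝ u (y - x) ≤ 0) : u = 0 := by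
  have hc : Tendsto (fun t : ℝ => x + t • u) (𝓝[>] 0) (𝓝 x) := by
    have : Continuous fun t : ℝ => x + t • u := by fun_prop
    simpa using (this.tendsto 0).mono_left nhdsWithin_le_nhds
  obtain ⟨t, ht, ht0⟩ := ((hc.eventually (hU.mem_nhds hx)).and self_mem_nhdsWithin).exists
  have h1 := h _ ht
  rw [add_sub_cancel_left, inner_smul_right] at h1
  have h2 : inner ℝ u u ≤ (0 : ℝ) := by
    by_contra hcon
    exact absurd h1 (not_le.2 (mul_pos ht0 (not_le.1 hcon)))
  rwa [real_inner_self_eq_norm_sq, sq_nonpos_iff, norm_eq_zero] at h2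

/-- The difference of the affine functions `j` and `i` is nonpositive on the open cell and vanishes
at `x`, so its linear part is nonpositive around `x` and hence zero. This gives both the
disjointness of the cells and the uniqueness of the optimal map. -/
lemma eq_of_mem_openCell_of_mem_contactSet (hz : ∀ i, ‖z i‖ ≤ R) (hα : BddAbove (range α))
    {x : E} {i j : ι} (hi : x ∈ openCell M z α i) (hj : x ∈ contactSet z α j) : z j = z i := by
  rw [← sub_eq_zero]
  refine eq_zero_of_inner_sub_nonpos (isOpen_openCell i) hi fun y hy => ?_
  have h1 := (mem_contactSet_iff hz hα).1 (openCell_subset_contactSet i hy) j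
  have h2 := (mem_contactSet_iff hz hα).1 hj i
  simp only [inner_sub_left, inner_sub_right]
  linarith

lemma pairwise_disjoint_openCell (hzi : Function.Injective z) (hz : ∀ i, ‖z i‖ ≤ R)
    (hα : BddAbove (range α)) :
    Pairwise fun i j => Disjoint (openCell M z α i) (openCell M z α j) := by
  intro i j hij
  rw [Set.disjoint_left]
  intro x hi hj
  exact hij (hzi (eq_of_mem_openCell_of_mem_contactSet hz hα hi
    (openCell_subset_contactSet j hj))).symm

lemma convex_openCell (hM : Convex ℝ M) (hz : ∀ i, ‖z i‖ ≤ R) (hα : BddAbove (range α)) (i : ι) :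
    Convex ℝ (openCell M z α i) :=
  (hM.inter (convex_contactSet hz hα i)).interior

lemma hasGradientAt_inner [CompleteSpace E] (y x : E) (c : ℝ) :
    HasGradientAt (fun x => inner ℝ y x + c) y x := by
  rw [hasGradientAt_iff_hasFDerivAt]
  exact (InnerProductSpace.toDual ℝ E y).hasFDerivAt.add_const c

lemma hasGradientAt_supAffine [CompleteSpace E] {i : ι} {x : E} (hx : x ∈ openCell M z α i) :
    HasGradientAt (supAffine z α) (z i) x := by
  refine (hasGradientAt_inner (z i) x (α i)).congr_of_eventuallyEq ?_
  filter_upwards [(isOpen_openCell i).mem_nhds hx] with y hy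
  exact openCell_subset_contactSet i hy

/-- A function differentiable at `x` with an affine minorant of slope `y` touching at `x` has
gradient `y` there. -/
lemma hasGradientAt_of_touching [CompleteSpace E] {f : E → ℝ} {x y : E}
    (hf : DifferentiableAt ℝ f x) (h : ∀ᶠ x' in 𝓝 x, f x + inner ℝ (x' - x) y ≤ f x') :
    HasGradientAt f y x := by
  have h1 := hf.hasGradientAt
  have h2 : HasFDerivAt (fun x' => f x' - inner ℝ y x')
      (InnerProductSpace.toDual ℝ E (gradient f x) - InnerProductSpace.toDual ℝ E y) x :=
    h1.hasFDerivAt.sub (InnerProductSpace.toDual ℝ E y).hasFDerivAt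
  have h3 : IsLocalMin (fun x' => f x' - inner ℝ y x') x := by
    filter_upwards [h] with x' hx'
    rw [inner_sub_left, real_inner_comm, real_inner_comm y x] at hx'
    linarith
  have h4 := h3.hasFDerivAt_eq_zero h2
  rw [sub_eq_zero] at h4
  rwa [(InnerProductSpace.toDual ℝ E).injective h4] at h1

lemma hasGradientAt_sub_sq_norm [CompleteSpace E] {f : E → ℝ} {x y : E}
    (hf : HasGradientAt f y x) : HasGradientAt (fun x => f x - ‖x‖ ^ 2 / 2) (y - x) x := by
  have h1 : HasFDerivAt (fun x : E => ‖x‖ ^ 2 / 2) (InnerProductSpace.toDual ℝ E x) x := by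
    have h2 := ((hasStrictFDerivAt_norm_sq x).hasFDerivAt).mul_const (2⁻¹ : ℝ)
    simp only [← div_eq_mul_inv] at h2
    refine h2.congr_fderiv ?_
    ext v
    simp
  rw [hasGradientAt_iff_hasFDerivAt, map_sub]
  exact hf.hasFDerivAt.sub h1

lemma sq_dist_half (x y : E) :
    dist x y ^ 2 / 2 = ‖x‖ ^ 2 / 2 + ‖y‖ ^ 2 / 2 - inner ℝ x y := by
  rw [dist_eq_norm, norm_sub_sq_real]
  ring

/-- A supremum of affine functions with slopes in `M` is `d²/2`-convex after subtraction of
`|·|²/2`. -/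
lemma isDSqConvex_supAffine [Nonempty ι] (hM : IsCompact M) (hzM : ∀ i, z i ∈ M)
    (hα : BddAbove (range α)) :
    IsDSqConvex M (fun x => supAffine z α x - ‖x‖ ^ 2 / 2) := by
  obtain ⟨R, hR⟩ := hM.isBounded.exists_norm_le
  have hz : ∀ i, ‖z i‖ ≤ R := fun i => hR _ (hzM i)
  have hne : M.Nonempty := ⟨_, hzM (Classical.arbitrary ι)⟩
  have hmax : ∀ y : E, ∃ x ∈ M, IsMaxOn (fun x => inner ℝ x y - supAffine z α x) M x := fun y =>
    hM.exists_isMaxOn hne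
      ((by fun_prop : Continuous fun x : E => inner ℝ x y).sub
        (continuous_supAffine hz hα)).continuousOn
  choose p hpM hp using hmax
  -- Biconjugation: `ψ` is the Legendre transform of φ₁ over `M` minus |·|²/2, with `p y` a
  -- maximizer. Young's inequality gives the lower bound. Testing at y = z_i, where the transform is
  -- at most −α_i, shows that it is the greatest one.
  refine ⟨fun y => inner ℝ (p y) y - supAffine z α (p y) - ‖y‖ ^ 2 / 2, fun x hx => ⟨?_, ?_⟩⟩
  · rintro _ ⟨y, -, rfl⟩
    have h1 : inner ℝ x y - supAffine z α x ≤ inner ℝ (p y) y - supAffine z α (p y) := hp y hx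
    dsimp only
    rw [sq_dist_half]
    linarith
  · intro b hb
    have h1 : supAffine z α x ≤ ‖x‖ ^ 2 / 2 - b := by
      refine supAffine_le fun i => ?_
      have h2 := hb (mem_image_of_mem _ (hzM i))
      dsimp only at h2
      rw [sq_dist_half] at h2
      have h3 := le_supAffine hz hα (p (z i)) i
      rw [real_inner_comm (p (z i)) (z i)] at h3
      rw [real_inner_comm]
      linarith
    linarith

end Affine

/-! ### Masses of the cells and optimality of ∇φ₁. -/

section Cells

variable {E : Type*} [NormedAddCommGroup E] [InnerProductSpace ℝ E] [FiniteDimensional ℝ E]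
  [MeasurableSpace E] [BorelSpace E] {ι : Type*}

lemma measurable_gradient (f : E → ℝ) : Measurable (gradient f) :=
  (InnerProductSpace.toDual ℝ E).symm.continuous.measurable.comp (measurable_fderiv ℝ f)

lemma measurable_expGrad (φ : E → ℝ) : Measurable (expGrad φ) :=
  measurable_id.add (measurable_gradient φ)

lemma ae_mem_interior {vol m : Measure E} [vol.IsAddHaarMeasure] {M : Set E}
    (hMc : IsClosed M) (hM : Convex ℝ M) (hm : m ≪ vol) (hm0 : m Mᶜ = 0) :
    ∀ᵐ x ∂m, x ∈ interior M := by
  have h1 : ∀ᵐ x ∂m, x ∈ M := hm0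
  have h2 : ∀ᵐ x ∂m, x ∉ frontier M := by
    rw [ae_iff]
    simpa using hm (hM.addHaar_frontier vol)
  filter_upwards [h1, h2] with x hx hx'
  rw [hMc.frontier_eq] at hx'
  by_contra h
  exact hx' ⟨hx, h⟩

lemma integrable_of_continuousOn {m : Measure E} [IsFiniteMeasure m] {M : Set E}
    (hM : IsCompact M) (hm0 : m Mᶜ = 0) {f : E → ℝ} (hf : ContinuousOn f M) :
    Integrable f m := by
  have := hf.integrableOn_compact (μ := m) hM
  rwa [IntegrableOn, Measure.restrict_eq_self_of_ae_mem hm0] at this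

/-- Passing to the interior loses only the boundary of a convex set, which is null for Haar measure.
-/
lemma measure_openCell_eq {vol m : Measure E} [vol.IsAddHaarMeasure] {M : Set E}
    {z : ι → E} {α : ι → ℝ} {R : ℝ} (hMc : IsClosed M) (hM : Convex ℝ M) (hm : m ≪ vol)
    (hm0 : m Mᶜ = 0) (hz : ∀ i, ‖z i‖ ≤ R) (hα : BddAbove (range α)) (i : ι) :
    m (openCell M z α i) = m (contactSet z α i) := by
  refine le_antisymm (measure_mono (openCell_subset_contactSet i)) ?_
  have h1 : m (frontier (M ∩ contactSet z α i)) = 0 :=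
    hm ((hM.inter (convex_contactSet hz hα i)).addHaar_frontier vol)
  have h2 : contactSet z α i ⊆
      openCell M z α i ∪ (frontier (M ∩ contactSet z α i) ∪ Mᶜ) := by
    intro x hx
    by_cases hxM : x ∈ M
    · rw [(hMc.inter (isClosed_contactSet hz hα i)).frontier_eq]
      by_cases hxi : x ∈ openCell M z α i
      · exact Or.inl hxi
      · exact Or.inr (Or.inl ⟨⟨hxM, hx⟩, hxi⟩)
    · exact Or.inr (Or.inr hxM)
  calc m (contactSet z α i)
      ≤ m (openCell M z α i ∪ (frontier (M ∩ contactSet z α i) ∪ Mᶜ)) := measure_mono h2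
    _ ≤ m (openCell M z α i) + (m (frontier (M ∩ contactSet z α i)) + m Mᶜ) :=
        (measure_union_le _ _).trans (by gcongr; exact measure_union_le _ _)
    _ = m (openCell M z α i) := by rw [h1, hm0, add_zero, add_zero]

variable [Countable ι]

lemma ae_mem_range_discreteMeasure (z : ι → E) (w : ι → ℝ≥0∞) :
    ∀ᵐ y ∂(discreteMeasure z w), y ∈ range z := by
  have hms : MeasurableSet (range z) := (countable_range z).measurableSet
  rw [ae_iff]
  change discreteMeasure z w (range z)ᶜ = 0
  rw [discreteMeasure, Measure.sum_apply _ hms.compl]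
  simp [hms.compl]

/-- The reference measure `m` on `M` gives the contact set of index `i` the mass `w i`. -/
structure HasCellMasses (vol : Measure E) (M : Set E) (m : Measure E) (z : ι → E) (w : ι → ℝ≥0∞)
    (α : ι → ℝ) : Prop where
  isCompact : IsCompact M
  convex : Convex ℝ M
  ac : m ≪ vol
  compl_null : m Mᶜ = 0
  injective : Function.Injective z
  mem : ∀ i, z i ∈ M
  tsum_eq : ∑' i, w i = 1
  bddAbove : BddAbove (range α)
  measure_contactSet : ∀ i, m (contactSet z α i) = w i

namespace HasCellMasses

variable {vol m : Measure E} [vol.IsAddHaarMeasure] [IsProbabilityMeasure m] {M : Set E}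
  {z : ι → E} {w : ι → ℝ≥0∞} {α : ι → ℝ}

lemma nonempty (h : HasCellMasses vol M m z w α) : Nonempty ι := by
  by_contra hne
  rw [not_nonempty_iff] at hne
  simpa using h.tsum_eq

lemma exists_bound (h : HasCellMasses vol M m z w α) :
    ∃ R, (∀ x ∈ M, ‖x‖ ≤ R) ∧ ∀ i, ‖z i‖ ≤ R := by
  obtain ⟨R, hR⟩ := h.isCompact.isBounded.exists_norm_le
  exact ⟨R, hR, fun i => hR _ (h.mem i)⟩

lemma measure_openCell (h : HasCellMasses vol M m z w α) (i : ι) :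
    m (openCell M z α i) = w i := by
  obtain ⟨R, hR, hz⟩ := h.exists_bound
  rw [measure_openCell_eq h.isCompact.isClosed h.convex h.ac h.compl_null hz h.bddAbove,
    h.measure_contactSet]

lemma pairwise_disjoint (h : HasCellMasses vol M m z w α) :
    Pairwise fun i j => Disjoint (openCell M z α i) (openCell M z α j) := by
  obtain ⟨R, hR, hz⟩ := h.exists_bound
  exact pairwise_disjoint_openCell h.injective hz h.bddAbove

/-- The open cells are disjoint and their masses already add up to 1. -/
lemma ae_mem_iUnion (h : HasCellMasses vol M m z w α) :
    ∀ᵐ x ∂m, x ∈ ⋃ i, openCell M z α i := by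
  have hms : MeasurableSet (⋃ i, openCell M z α i) :=
    (isOpen_iUnion fun i => isOpen_openCell i).measurableSet
  refine (prob_compl_eq_zero_iff hms).2 ?_
  rw [measure_iUnion h.pairwise_disjoint fun i => (isOpen_openCell i).measurableSet, ← h.tsum_eq]
  exact tsum_congr h.measure_openCell

lemma gradient_eq {i : ι} {x : E} (hx : x ∈ openCell M z α i) :
    gradient (supAffine z α) x = z i :=
  (hasGradientAt_supAffine hx).gradient

lemma map_eq_discreteMeasure (h : HasCellMasses vol M m z w α) {g : E → E} (hg : Measurable g)
    (hgz : ∀ i, ∀ x ∈ openCell M z α i, g x = z i) : m.map g = discreteMeasure z w := by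
  ext s hs
  rw [Measure.map_apply hg hs, discreteMeasure, Measure.sum_apply _ hs,
    ← measure_inter_conull (t := ⋃ i, openCell M z α i) h.ae_mem_iUnion, inter_iUnion,
    measure_iUnion (fun i j hij => ((h.pairwise_disjoint hij).mono inter_subset_right
      inter_subset_right)) fun i => (hg hs).inter (isOpen_openCell i).measurableSet]
  congr 1
  ext i
  rw [Measure.smul_apply, Measure.dirac_apply' _ hs, smul_eq_mul, ← h.measure_openCell i]
  by_cases hi : z i ∈ s
  · rw [indicator_of_mem hi, Pi.one_apply, mul_one]
    congr 1
    refine inter_eq_right.2 fun x hx => ?_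
    rw [mem_preimage, hgz i x hx]
    exact hi
  · rw [indicator_of_notMem hi, mul_zero]
    convert measure_empty (μ := m)
    ext x
    simp only [mem_inter_iff, mem_preimage, mem_empty_iff_false, iff_false, not_and]
    intro hx hxi
    rw [hgz i x hxi] at hx
    exact hi hx

lemma map_gradient (h : HasCellMasses vol M m z w α) :
    m.map (gradient (supAffine z α)) = discreteMeasure z w :=
  h.map_eq_discreteMeasure (measurable_gradient _) fun _ _ hx => gradient_eq hx

lemma ae_exists_of_map_eq {g : E → E} (hg : Measurable g)
    (hmap : m.map g = discreteMeasure z w) : ∀ᵐ x ∂m, ∃ i, z i = g x := by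
  have := ae_mem_range_discreteMeasure z w
  rw [← hmap] at this
  exact ae_of_ae_map hg.aemeasurable this

lemma integrable_inner (h : HasCellMasses vol M m z w α) {g : E → E} (hg : Measurable g)
    (hmap : m.map g = discreteMeasure z w) : Integrable (fun x => inner ℝ (g x) x) m := by
  obtain ⟨R, hR, hz⟩ := h.exists_bound
  refine Integrable.of_bound (hg.inner measurable_id).aestronglyMeasurable (R * R) ?_
  have hM : ∀ᵐ x ∂m, x ∈ M := h.compl_null
  filter_upwards [ae_exists_of_map_eq hg hmap, hM] with x ⟨i, hi⟩ hx
  rw [← hi]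
  exact (norm_inner_le_norm _ _).trans
    (mul_le_mul (hz i) (hR x hx) (norm_nonneg _) ((norm_nonneg _).trans (hz i)))

/-- Among the maps pushing `m` to the discrete measure, `∇φ₁` maximizes the correlation with the
identity, and it is the only maximizer. -/
lemma integral_inner_le (h : HasCellMasses vol M m z w α) {g : E → E} (hg : Measurable g)
    (hmap : m.map g = discreteMeasure z w) :
    (∫ x, inner ℝ (g x) x ∂m ≤ ∫ x, inner ℝ (gradient (supAffine z α) x) x ∂m) ∧
    (∫ x, inner ℝ (gradient (supAffine z α) x) x ∂m ≤ ∫ x, inner ℝ (g x) x ∂m →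
      ∀ᵐ x ∂m, ∀ i, x ∈ openCell M z α i → g x = z i) := by
  obtain ⟨R, hR, hz⟩ := h.exists_bound
  have := h.nonempty
  set T := gradient (supAffine z α) with hT
  have hTm : Measurable T := measurable_gradient _
  have hTmap : m.map T = discreteMeasure z w := h.map_gradient
  -- The weights become a function on the whole space, zero off the sites; it is measurable because
  -- only countably many values are nonzero.
  set a : E → ℝ := Function.extend z α 0 with ha
  have haz : ∀ i, a (z i) = α i := fun i => h.injective.extend_apply α 0 i
  have ham : Measurable a := by
    refine measurable_zero.measurable_of_countable_ne ((countable_range z).mono fun x hx => ?_)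
    by_contra hxr
    refine hx ?_
    rw [ha, Function.extend_apply' _ _ _ hxr]
  have hφ : Integrable (supAffine z α) m :=
    integrable_of_continuousOn h.isCompact h.compl_null (continuous_supAffine hz h.bddAbove).continuousOn
  have hTi := h.integrable_inner hTm hTmap
  have hgi := h.integrable_inner hg hmap
  have hTeq : ∀ᵐ x ∂m, supAffine z α x - inner ℝ (T x) x = a (T x) := by
    filter_upwards [h.ae_mem_iUnion] with x hx
    obtain ⟨i, hi⟩ := mem_iUnion.1 hx
    have h1 : supAffine z α x = inner ℝ (z i) x + α i := openCell_subset_contactSet i hi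
    rw [hT, gradient_eq hi, haz, h1]
    ring
  -- The weights are bounded above only, so `a` need not be bounded. Its integrability comes from
  -- φ₁(x) − ⟨T x, x⟩ = a(T x), and passes to any `g` through the common law.
  have haT : Integrable (fun x => a (T x)) m := (hφ.sub hTi).congr hTeq
  have haμ : Integrable a (discreteMeasure z w) := by
    rw [← hTmap, integrable_map_measure ham.aestronglyMeasurable hTm.aemeasurable]
    exact haT
  have hag : Integrable (fun x => a (g x)) m := by
    rw [← hmap, integrable_map_measure ham.aestronglyMeasurable hg.aemeasurable] at haμ
    exact haμ
  have hint : ∫ x, a (g x) ∂m = ∫ x, a (T x) ∂m := by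
    rw [← integral_map hg.aemeasurable ham.aestronglyMeasurable, hmap, ← hTmap,
      integral_map hTm.aemeasurable ham.aestronglyMeasurable]
  have hge : ∀ᵐ x ∂m, 0 ≤ supAffine z α x - inner ℝ (g x) x - a (g x) := by
    filter_upwards [ae_exists_of_map_eq hg hmap] with x ⟨i, hi⟩
    rw [← hi, haz]
    linarith [le_supAffine hz h.bddAbove x i]
  have hTint : ∫ x, supAffine z α x ∂m - ∫ x, inner ℝ (T x) x ∂m = ∫ x, a (T x) ∂m := by
    rw [← integral_sub hφ hTi]
    exact integral_congr_ae hTeq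
  have hgint : ∫ x, (supAffine z α x - inner ℝ (g x) x - a (g x)) ∂m =
      ∫ x, supAffine z α x ∂m - ∫ x, inner ℝ (g x) x ∂m - ∫ x, a (g x) ∂m := by
    rw [← integral_sub hφ hgi]
    exact integral_sub (hφ.sub hgi) hag
  have hnn := integral_nonneg_of_ae hge
  refine ⟨by linarith, fun hle => ?_⟩
  have hzero : ∫ x, (supAffine z α x - inner ℝ (g x) x - a (g x)) ∂m = 0 :=
    le_antisymm (by linarith) hnn
  have hae := (integral_eq_zero_iff_of_nonneg_ae hge ((hφ.sub hgi).sub hag)).1 hzero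
  filter_upwards [hae, ae_exists_of_map_eq hg hmap] with x hx ⟨j, hj⟩ i hi
  have hcontact : x ∈ contactSet z α j := by
    have hx' : supAffine z α x - inner ℝ (g x) x - a (g x) = 0 := hx
    rw [← hj, haz] at hx'
    change supAffine z α x = inner ℝ (z j) x + α j
    linarith
  rw [← hj]
  exact eq_of_mem_openCell_of_mem_contactSet hz h.bddAbove hi hcontact

/-- The transport cost of a map pushing `m` to the discrete measure, in terms of its correlation
with the identity. -/
lemma integral_sq_dist (h : HasCellMasses vol M m z w α) {g : E → E} (hg : Measurable g)
    (hmap : m.map g = discreteMeasure z w) :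
    ∫ x, dist x (g x) ^ 2 ∂m = ∫ x, ‖x‖ ^ 2 ∂m + ∫ y, ‖y‖ ^ 2 ∂(discreteMeasure z w)
      - 2 * ∫ x, inner ℝ (g x) x ∂m := by
  obtain ⟨R, hR, hz⟩ := h.exists_bound
  have h1 : Integrable (fun x : E => ‖x‖ ^ 2) m :=
    integrable_of_continuousOn h.isCompact h.compl_null (by fun_prop)
  have h2 : Integrable (fun x => ‖g x‖ ^ 2) m := by
    refine Integrable.of_bound (hg.norm.pow_const 2).aestronglyMeasurable (R ^ 2) ?_
    filter_upwards [ae_exists_of_map_eq hg hmap] with x ⟨i, hi⟩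
    rw [← hi, norm_pow, norm_norm]
    exact pow_le_pow_left₀ (norm_nonneg _) (hz i) 2
  have h3 := h.integrable_inner hg hmap
  -- The second moment of `g` depends only on its law, so only the correlation varies with `g`.
  have h4 : ∫ y, ‖y‖ ^ 2 ∂(discreteMeasure z w) = ∫ x, ‖g x‖ ^ 2 ∂m := by
    rw [← hmap, integral_map hg.aemeasurable (by fun_prop)]
  rw [h4, ← integral_const_mul, ← integral_add h1 h2]
  refine Eq.trans ?_ (integral_sub (h1.add h2) (h3.const_mul 2))
  congr 1
  ext x
  rw [dist_eq_norm, norm_sub_sq_real, real_inner_comm]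
  ring

/-- There is an optimal transport map with the same correlation with the identity as `∇φ₁`. -/
lemma exists_isOptimalTransportMap (h : HasCellMasses vol M m z w α) :
    ∃ g, IsOptimalTransportMap M m (discreteMeasure z w) g ∧
      ∫ x, inner ℝ (g x) x ∂m = ∫ x, inner ℝ (gradient (supAffine z α) x) x ∂m := by
  classical
  obtain ⟨i₀⟩ := h.nonempty
  have hms : MeasurableSet (⋃ i, openCell M z α i) :=
    (isOpen_iUnion fun i => isOpen_openCell i).measurableSet
  -- A transport map must send every point of `M` into `M`, but off the cells the gradient may take
  -- its default value 0, which need not lie in `M`; a site is used there instead.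
  set g : E → E := (⋃ i, openCell M z α i).piecewise (gradient (supAffine z α)) fun _ => z i₀
    with hgdef
  have hgz : ∀ i, ∀ x ∈ openCell M z α i, g x = z i := fun i x hx => by
    rw [hgdef, piecewise_eq_of_mem _ _ _ (mem_iUnion.2 ⟨i, hx⟩), gradient_eq hx]
  have hg : Measurable g := (measurable_gradient _).piecewise hms measurable_const
  have hmap := h.map_eq_discreteMeasure hg hgz
  have hae : ∫ x, inner ℝ (g x) x ∂m = ∫ x, inner ℝ (gradient (supAffine z α) x) x ∂m := by
    refine integral_congr_ae ?_
    filter_upwards [h.ae_mem_iUnion] with x hx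
    rw [hgdef, piecewise_eq_of_mem _ _ _ hx]
  refine ⟨g, ⟨hg, fun x _ => ?_, hmap, fun k hk _ hkmap => ?_⟩, hae⟩
  · by_cases hx : x ∈ ⋃ i, openCell M z α i
    · obtain ⟨i, hi⟩ := mem_iUnion.1 hx
      rw [hgz i x hi]
      exact h.mem i
    · rw [hgdef, piecewise_eq_of_notMem _ _ _ hx]
      exact h.mem i₀
  · rw [h.integral_sq_dist hg hmap, h.integral_sq_dist hk hkmap, hae]
    linarith [(h.integral_inner_le hk hkmap).1]

/-- An optimal map costs no more than the explicit competitor, so it attains the maximal correlation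
and the equality case of `integral_inner_le` applies. -/
lemma ae_eq_of_isOptimalTransportMap (h : HasCellMasses vol M m z w α) {g : E → E}
    (hg : IsOptimalTransportMap M m (discreteMeasure z w) g) :
    ∀ᵐ x ∂m, ∀ i, x ∈ openCell M z α i → g x = z i := by
  obtain ⟨k, hk, hkeq⟩ := h.exists_isOptimalTransportMap
  refine (h.integral_inner_le hg.measurable hg.map_eq).2 ?_
  have h1 := hg.optimal k hk.measurable hk.mapsTo hk.map_eq
  rw [h.integral_sq_dist hg.measurable hg.map_eq,
    h.integral_sq_dist hk.measurable hk.map_eq, hkeq] at h1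
  linarith

lemma exists_isConjugateMeasure (h : HasCellMasses vol M m z w α) :
    ∃ ν, IsConjugateMeasure M m (discreteMeasure z w) ν := by
  have := h.nonempty
  refine ⟨_, fun x => supAffine z α x - ‖x‖ ^ 2 / 2,
    isDSqConvex_supAffine h.isCompact h.mem h.bddAbove,
    h.map_eq_discreteMeasure (measurable_expGrad _) fun i x hx => ?_, rfl⟩
  have h1 := hasGradientAt_sub_sq_norm (hasGradientAt_supAffine hx)
  rw [expGrad, h1.gradient, add_sub_cancel]

end HasCellMasses

end Cells

/-! ### Legendre pairs on `M` and the support of the conjugate measure. -/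

section Conjugate

variable {E : Type*} [NormedAddCommGroup E] [InnerProductSpace ℝ E] {M : Set E}

/-- `f` and `c` satisfy Young's inequality on `M`, and every point of `M` has a partner in `M` for
which equality holds. -/
structure IsDualPotential (M : Set E) (f c : E → ℝ) : Prop where
  young : ∀ x ∈ M, ∀ y ∈ M, inner ℝ x y ≤ f x + c y
  exists_eq : ∀ x ∈ M, ∃ y ∈ M, f x + c y = inner ℝ x y

lemma IsDualPotential.sub_le {f c : E → ℝ} (h : IsDualPotential M f c) {R : ℝ}
    (hR : ∀ x ∈ M, ‖x‖ ≤ R) {x x' : E} (hx : x ∈ M) (hx' : x' ∈ M) :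
    f x - f x' ≤ R * ‖x - x'‖ := by
  obtain ⟨y, hy, hxy⟩ := h.exists_eq x hx
  have h1 := h.young x' hx' y hy
  have h2 := real_inner_le_norm (x - x') y
  have h3 := mul_le_mul_of_nonneg_left (hR y hy) (norm_nonneg (x - x'))
  rw [inner_sub_left] at h2
  linarith

lemma lipschitzOnWith_of_sub_le {f : E → ℝ} {R : ℝ}
    (hf : ∀ x ∈ M, ∀ y ∈ M, f x - f y ≤ R * ‖x - y‖) : LipschitzOnWith R.toNNReal f M :=
  LipschitzOnWith.of_le_add_mul' R fun x hx y hy => by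
    rw [dist_eq_norm]
    linarith [hf x hx y hy]

lemma IsDualPotential.lipschitzOnWith {f c : E → ℝ} (h : IsDualPotential M f c) {R : ℝ}
    (hR : ∀ x ∈ M, ‖x‖ ≤ R) : LipschitzOnWith R.toNNReal f M :=
  lipschitzOnWith_of_sub_le fun _ hx _ hy => h.sub_le hR hx hy

/-- A dual potential is differentiable almost everywhere, its gradient being the partner in
Young's inequality. -/
lemma IsDualPotential.ae_hasGradientAt [FiniteDimensional ℝ E] [MeasurableSpace E] [BorelSpace E]
    {vol m : Measure E} [vol.IsAddHaarMeasure] {f c : E → ℝ} (h : IsDualPotential M f c)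
    (hMc : IsCompact M) (hM : Convex ℝ M) (hm : m ≪ vol) (hm0 : m Mᶜ = 0) :
    ∀ᵐ x ∂m, x ∈ M ∧ ∃ y ∈ M, f x + c y = inner ℝ x y ∧ HasGradientAt f y x := by
  obtain ⟨R, hR⟩ := hMc.isBounded.exists_norm_le
  have h1 := hm.ae_le ((h.lipschitzOnWith hR).ae_differentiableWithinAt_of_mem (μ := vol))
  filter_upwards [h1, ae_mem_interior hMc.isClosed hM hm hm0] with x hx hxi
  have hxM := interior_subset hxi
  have hnhds : M ∈ 𝓝 x := mem_interior_iff_mem_nhds.1 hxi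
  obtain ⟨y, hy, hxy⟩ := h.exists_eq x hxM
  refine ⟨hxM, y, hy, hxy, hasGradientAt_of_touching ((hx hxM).differentiableAt hnhds) ?_⟩
  filter_upwards [hnhds] with x' hx'
  have h2 := h.young x' hx' y hy
  rw [inner_sub_left]
  linarith

/-- A `d²/2`-convex function and its conjugate, shifted by `|·|²/2`, are dual potentials of each
other. -/
lemma IsDSqConvex.isDualPotential {φ : E → ℝ} (h : IsDSqConvex M φ) (hMc : IsCompact M)
    (hne : M.Nonempty) :
    IsDualPotential M (fun x => φ x + ‖x‖ ^ 2 / 2) (fun x => conj M φ x + ‖x‖ ^ 2 / 2) ∧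
    IsDualPotential M (fun x => conj M φ x + ‖x‖ ^ 2 / 2) (fun x => φ x + ‖x‖ ^ 2 / 2) := by
  obtain ⟨ψ, hψ⟩ := h
  obtain ⟨R, hR⟩ := hMc.isBounded.exists_norm_le
  set f : E → ℝ := fun x => φ x + ‖x‖ ^ 2 / 2 with hf
  set c : E → ℝ := fun x => conj M φ x + ‖x‖ ^ 2 / 2 with hc
  have hfψ : ∀ x ∈ M, ∀ y ∈ M, inner ℝ x y - (ψ y + ‖y‖ ^ 2 / 2) ≤ f x := fun x hx y hy => by
    have h1 := (hψ x hx).1 (mem_image_of_mem _ hy)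
    rw [sq_dist_half] at h1
    simp only [hf]
    linarith
  have hfle : ∀ x ∈ M, ∀ b, (∀ y ∈ M, inner ℝ x y - (ψ y + ‖y‖ ^ 2 / 2) ≤ b) → f x ≤ b :=
    fun x hx b hb => by
      have h1 : ‖x‖ ^ 2 / 2 - b ≤ -φ x := by
        refine (hψ x hx).2 ?_
        rintro _ ⟨y, hy, rfl⟩
        have h2 := hb y hy
        dsimp only
        rw [sq_dist_half]
        linarith
      simp only [hf]
      linarith
  -- As a supremum of affine functions with slopes in `M`, `f` is `R`-Lipschitz. Continuity makes
  -- the infimum defining `conj` an attained minimum.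
  have hfcont : ContinuousOn f M := by
    refine (lipschitzOnWith_of_sub_le (R := R) fun x hx x' hx' => ?_).continuousOn
    rw [sub_le_iff_le_add]
    refine hfle x hx _ fun y hy => ?_
    have h1 := hfψ x' hx' y hy
    have h2 := real_inner_le_norm (x - x') y
    have h3 := mul_le_mul_of_nonneg_left (hR y hy) (norm_nonneg (x - x'))
    rw [inner_sub_left] at h2
    linarith
  have hcsup : ∀ y, ∃ x ∈ M, c y + f x = inner ℝ y x ∧ ∀ x' ∈ M, inner ℝ y x' ≤ c y + f x' := by
    intro y
    obtain ⟨x, hx, hmin⟩ := hMc.exists_isMinOn hne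
      (hfcont.sub (by fun_prop : Continuous fun x => inner ℝ y x).continuousOn)
    have hval : ∀ x, dist y x ^ 2 / 2 + φ x = f x - inner ℝ y x + ‖y‖ ^ 2 / 2 := fun x => by
      rw [sq_dist_half]
      simp only [hf]
      ring
    have hleast : IsLeast ((fun x => dist y x ^ 2 / 2 + φ x) '' M)
        (dist y x ^ 2 / 2 + φ x) := by
      refine ⟨mem_image_of_mem _ hx, ?_⟩
      rintro _ ⟨x', hx', rfl⟩
      have h1 : f x - inner ℝ y x ≤ f x' - inner ℝ y x' := hmin hx'
      dsimp only
      rw [hval, hval]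
      linarith
    have hcy : c y = inner ℝ y x - f x := by
      simp only [hc, conj]
      rw [hleast.csInf_eq, hval]
      ring
    refine ⟨x, hx, by rw [hcy]; ring, fun x' hx' => ?_⟩
    have h1 : f x - inner ℝ y x ≤ f x' - inner ℝ y x' := hmin hx'
    rw [hcy]
    linarith
  have hcf : IsDualPotential M c f := by
    refine ⟨fun y _ x hx => ?_, fun y _ => ?_⟩
    · obtain ⟨-, -, -, h1⟩ := hcsup y
      exact h1 x hx
    · obtain ⟨x, hx, h1, -⟩ := hcsup y
      exact ⟨x, hx, h1⟩
  refine ⟨⟨fun x hx y hy => ?_, fun x hx => ?_⟩, hcf⟩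
  · have h1 := hcf.young y hy x hx
    rw [real_inner_comm]
    linarith
  -- The partner of `x` maximizes ⟨x, y⟩ − c(y). Since c ≤ ψ + |·|²/2 on `M`, this maximum dominates
  -- the supremum that represents f(x).
  · obtain ⟨y, hy, hmax⟩ := hMc.exists_isMaxOn hne
      ((by fun_prop : Continuous fun y => inner ℝ x y).continuousOn.sub
        (hcf.lipschitzOnWith hR).continuousOn)
    refine ⟨y, hy, le_antisymm ?_ ?_⟩
    · rw [← le_sub_iff_add_le]
      refine hfle x hx _ fun y' hy' => ?_
      have h1 : inner ℝ x y' - c y' ≤ inner ℝ x y - c y := hmax hy'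
      obtain ⟨x', hx', h2⟩ := hcf.exists_eq y' hy'
      have h3 := hfψ x' hx' y' hy'
      rw [real_inner_comm] at h2
      linarith
    · have h1 := hcf.young y hy x hx
      rw [real_inner_comm]
      linarith

variable [FiniteDimensional ℝ E] [MeasurableSpace E] [BorelSpace E] {ι : Type*} [Countable ι]
  {vol m : Measure E} [vol.IsAddHaarMeasure] [IsProbabilityMeasure m]
  {z : ι → E} {w : ι → ℝ≥0∞} {α : ι → ℝ}

lemma expGrad_eq {φ : E → ℝ} {x y : E} (h : HasGradientAt (fun x => φ x + ‖x‖ ^ 2 / 2) y x) :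
    expGrad φ x = y := by
  have h1 := hasGradientAt_sub_sq_norm h
  simp only [add_sub_cancel_right] at h1
  rw [expGrad, h1.gradient, add_sub_cancel]

/-- A map to the discrete measure induced by a dual potential agrees almost everywhere with the
map constant on the cells. -/
lemma HasCellMasses.ae_eq_of_isDualPotential (h : HasCellMasses vol M m z w α) {f c : E → ℝ}
    (hfc : IsDualPotential M f c) (hcf : IsDualPotential M c f) {g : E → E} (hg : Measurable g)
    (hmap : m.map g = discreteMeasure z w)
    (hgf : ∀ᵐ x ∂m, f x + c (g x) = inner ℝ x (g x)) :
    ∀ᵐ x ∂m, ∀ i, x ∈ openCell M z α i → g x = z i := by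
  refine (h.integral_inner_le hg hmap).2 ?_
  obtain ⟨R, hR, hz⟩ := h.exists_bound
  set T := gradient (supAffine z α) with hT
  have hTm : Measurable T := measurable_gradient _
  have hTmap : m.map T = discreteMeasure z w := h.map_gradient
  have hfcont := (hfc.lipschitzOnWith hR).continuousOn
  have hccont := (hcf.lipschitzOnWith hR).continuousOn
  have hMμ : ∀ᵐ y ∂(discreteMeasure z w), y ∈ M := by
    filter_upwards [ae_mem_range_discreteMeasure z w] with y ⟨i, hi⟩
    exact hi ▸ h.mem i
  have : IsProbabilityMeasure (discreteMeasure z w) :=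
    hTmap ▸ Measure.isProbabilityMeasure_map hTm.aemeasurable
  have hcμ : Integrable c (discreteMeasure z w) :=
    integrable_of_continuousOn h.isCompact hMμ hccont
  have hf : Integrable f m := integrable_of_continuousOn h.isCompact h.compl_null hfcont
  have hcT : Integrable (fun x => c (T x)) m :=
    Integrable.comp_measurable (by rwa [hTmap]) hTm
  have hcg : Integrable (fun x => c (g x)) m :=
    Integrable.comp_measurable (by rwa [hmap]) hg
  have hint : ∫ x, c (g x) ∂m = ∫ x, c (T x) ∂m := by
    rw [← integral_map hg.aemeasurable (by rw [hmap]; exact hcμ.aestronglyMeasurable), hmap,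
      ← integral_map hTm.aemeasurable (by rw [hTmap]; exact hcμ.aestronglyMeasurable), hTmap]
  have hMm : ∀ᵐ x ∂m, x ∈ M := h.compl_null
  -- Weak duality for `T` against equality for `g`: both dual values are ∫f dm + ∫c dμ, so the
  -- correlation of `g` is at least that of `T`.
  have h1 : ∫ x, inner ℝ (T x) x ∂m ≤ ∫ x, (f x + c (T x)) ∂m := by
    refine integral_mono_ae (h.integrable_inner hTm hTmap) (hf.add hcT) ?_
    filter_upwards [hMm, ae_exists_of_map_eq hTm hTmap] with x hx ⟨i, hi⟩
    rw [← hi, real_inner_comm]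
    exact hfc.young x hx _ (h.mem i)
  have h2 : ∫ x, inner ℝ (g x) x ∂m = ∫ x, (f x + c (g x)) ∂m := by
    refine integral_congr_ae ?_
    filter_upwards [hgf] with x hx
    rw [hx, real_inner_comm]
  rw [integral_add hf hcT] at h1
  rw [integral_add hf hcg] at h2
  linarith

/-- The conjugate map sends almost every point to the complement of the open cells. -/
lemma HasCellMasses.ae_conj_mem (h : HasCellMasses vol M m z w α) (hsupp : m.support = M)
    [NullSingletonClass vol] {φ : E → ℝ} (hφ : IsDSqConvex M φ)
    (hmap : m.map (expGrad φ) = discreteMeasure z w) :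
    ∀ᵐ x ∂m, expGrad (conj M φ) x ∈ M \ ⋃ i, openCell M z α i := by
  have hne : M.Nonempty := h.nonempty.elim fun i => ⟨_, h.mem i⟩
  set f : E → ℝ := fun x => φ x + ‖x‖ ^ 2 / 2
  set c : E → ℝ := fun x => conj M φ x + ‖x‖ ^ 2 / 2
  obtain ⟨hfc, hcf⟩ : IsDualPotential M f c ∧ IsDualPotential M c f :=
    hφ.isDualPotential h.isCompact hne
  have hgf := hfc.ae_hasGradientAt h.isCompact h.convex h.ac h.compl_null
  have hgc := hcf.ae_hasGradientAt h.isCompact h.convex h.ac h.compl_null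
  have hcell := h.ae_eq_of_isDualPotential hfc hcf (measurable_expGrad φ) hmap (by
    filter_upwards [hgf] with x ⟨_, y, _, hxy, hgrad⟩
    rw [expGrad_eq hgrad]
    exact hxy)
  have hsub : ∀ᵐ x ∂m, ∀ i, x ∈ openCell M z α i →
      ∀ x' ∈ M, f x + inner ℝ (x' - x) (z i) ≤ f x' := by
    filter_upwards [hgf, hcell] with x ⟨_, y, hy, hxy, hgrad⟩ hx i hi x' hx'
    rw [← hx i hi, expGrad_eq hgrad, inner_sub_left]
    linarith [hfc.young x' hx' y hy]
  have hz : ∀ᵐ x ∂m, ∀ i, x ≠ z i := by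
    have h1 : m (range z) = 0 := h.ac ((countable_range z).measure_zero vol)
    filter_upwards [measure_eq_zero_iff_ae_notMem.1 h1] with x hx i hi
    exact hx ⟨i, hi.symm⟩
  filter_upwards [hgc, hz] with x ⟨hxM, y, hy, hxy, hgrad⟩ hxz
  rw [expGrad_eq hgrad]
  refine ⟨hy, fun hyU => ?_⟩
  obtain ⟨i, hi⟩ := mem_iUnion.1 hyU
  -- It suffices that ⟨x − z_i, v − y⟩ ≤ 0 for all `v` in the cell. For almost every such `v` this
  -- follows by adding the subgradient inequality of slope z_i at `v` to that of slope `x` at `y`.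
  refine hxz i (sub_eq_zero.1 (eq_zero_of_inner_sub_nonpos (isOpen_openCell i) hi
    fun y' hy' => ?_))
  by_contra hcon
  rw [not_le] at hcon
  -- A violation would persist on a nonempty open subset of the cell. Full support gives that subset
  -- positive mass, so it contains a `v` at which `hsub` holds.
  have hV : openCell M z α i ∩ {y' | 0 < inner ℝ (x - z i) (y' - y)} ∈ 𝓝 y' :=
    ((isOpen_openCell i).inter (isOpen_lt continuous_const (by fun_prop))).mem_nhds ⟨hy', hcon⟩
  have hpos : 0 < m (openCell M z α i ∩ {y' | 0 < inner ℝ (x - z i) (y' - y)}) :=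
    (Measure.mem_support_iff_forall y').1 (hsupp.symm ▸ openCell_subset i hy') _ hV
  obtain ⟨v, ⟨hvi, hv⟩, hvs⟩ := (frequently_ae_mem_iff.2 hpos.ne').and_eventually hsub |>.exists
  have h1 := hvs i hvi y hy
  have h2 := hcf.young x hxM v (openCell_subset i hvi)
  have hv' : 0 < inner ℝ (x - z i) (v - y) := hv
  rw [inner_sub_left, inner_sub_right, inner_sub_right] at hv'
  rw [inner_sub_left, real_inner_comm, real_inner_comm (z i) v] at h1
  linarith

end Conjugate

/-! ### Finite surface measure of compact convex sets. -/

section Hausdorff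

/-- The boundary of the cube `[-R, R]ⁿ` has finite `(n-1)`-dimensional Hausdorff measure. -/
lemma hausdorffMeasure_cube_boundary_lt_top (k : ℕ) (R : ℝ) :
    Measure.hausdorffMeasure (k : ℝ)
      {x : EuclideanSpace ℝ (Fin (k + 1)) | ‖WithLp.ofLp x‖ = R} < ∞ := by
  have hface : ∀ (j : Fin (k + 1)) (s : ℝ), Measure.hausdorffMeasure (k : ℝ)
      ((fun y : Fin k → ℝ => (WithLp.toLp 2 (j.insertNth s y) : EuclideanSpace ℝ (Fin (k + 1))))
        '' Metric.closedBall 0 R) < ∞ := by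
    intro j s
    have h1 : LipschitzWith 1 fun y : Fin k → ℝ => (j.insertNth s y : Fin (k + 1) → ℝ) := by
      refine LipschitzWith.of_dist_le_mul fun y y' => ?_
      rw [NNReal.coe_one, one_mul, dist_pi_le_iff dist_nonneg]
      intro i
      refine Fin.succAboveCases j ?_ (fun i => ?_) i
      · simp
      · simpa using dist_le_pi_dist y y' i
    have h2 := (PiLp.lipschitzWith_toLp 2 fun _ : Fin (k + 1) => ℝ).comp h1
    refine (h2.hausdorffMeasure_image_le k.cast_nonneg _).trans_lt ?_
    refine ENNReal.mul_lt_top (ENNReal.rpow_lt_top_of_nonneg k.cast_nonneg ENNReal.coe_ne_top) ?_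
    have h3 := hausdorffMeasure_pi_real (ι := Fin k)
    rw [Fintype.card_fin] at h3
    rw [h3]
    exact measure_closedBall_lt_top
  refine (measure_mono (t := ⋃ j : Fin (k + 1), ⋃ b : Bool,
    (fun y : Fin k → ℝ => (WithLp.toLp 2 (j.insertNth (if b then R else -R) y) :
      EuclideanSpace ℝ (Fin (k + 1)))) '' Metric.closedBall 0 R) fun x hx => ?_).trans_lt ?_
  · obtain ⟨j, hj⟩ : ∃ j, ‖x j‖ = R := by
      obtain ⟨j, hj⟩ := Finite.exists_max fun i => ‖x i‖
      refine ⟨j, le_antisymm ?_ ?_⟩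
      · rw [← show ‖WithLp.ofLp x‖ = R from hx]
        exact norm_le_pi_norm (WithLp.ofLp x) j
      · rw [← show ‖WithLp.ofLp x‖ = R from hx]
        exact (pi_norm_le_iff_of_nonneg (norm_nonneg _)).2 hj
    have hb : ∃ b : Bool, x j = if b then R else -R := by
      rw [Real.norm_eq_abs] at hj
      rcases abs_choice (x j) with h | h
      · exact ⟨true, by rw [if_pos rfl]; linarith⟩
      · exact ⟨false, by rw [if_neg (by simp)]; linarith⟩
    obtain ⟨b, hb⟩ := hb
    refine mem_iUnion.2 ⟨j, mem_iUnion.2 ⟨b, j.removeNth (WithLp.ofLp x), ?_, ?_⟩⟩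
    · rw [mem_closedBall_zero_iff, ← show ‖WithLp.ofLp x‖ = R from hx]
      exact (pi_norm_le_iff_of_nonneg (norm_nonneg _)).2 fun i => norm_le_pi_norm (WithLp.ofLp x) _
    · dsimp only
      rw [← hb]
      simp
  · exact (measure_iUnion_le _).trans_lt (by
      rw [tsum_fintype]
      refine ENNReal.sum_lt_top.2 fun j _ => (measure_iUnion_le _).trans_lt ?_
      rw [tsum_fintype]
      exact ENNReal.sum_lt_top.2 fun b _ => hface j _)

/-- The nearest-point projection onto a nonempty compact convex set. -/
lemma exists_projection {E : Type*} [NormedAddCommGroup E] [InnerProductSpace ℝ E] {K : Set E}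
    (hK : IsCompact K) (hKc : Convex ℝ K) (hne : K.Nonempty) :
    ∃ P : E → E, ∀ u, P u ∈ K ∧ ∀ y ∈ K, inner ℝ (u - P u) (y - P u) ≤ 0 := by
  have : ∀ u, ∃ v ∈ K, ∀ y ∈ K, inner ℝ (u - v) (y - v) ≤ 0 := fun u => by
    obtain ⟨v, hv, h⟩ := exists_norm_eq_iInf_of_complete_convex hne hK.isComplete hKc u
    exact ⟨v, hv, (norm_eq_iInf_iff_real_inner_le_zero hKc hv).1 h⟩
  choose P hP h using this
  exact ⟨P, fun u => ⟨hP u, h u⟩⟩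

/-- The nearest-point projection onto `K` is 1-Lipschitz, and it maps the surface of a cube
containing `K` onto a set that covers the boundary of `K`. -/
lemma hausdorffMeasure_diff_interior_lt_top {k : ℕ} {K : Set (EuclideanSpace ℝ (Fin (k + 1)))}
    (hK : IsCompact K) (hKc : Convex ℝ K) :
    Measure.hausdorffMeasure (k : ℝ) (K \ interior K) < ∞ := by
  rcases K.eq_empty_or_nonempty with rfl | hne
  · simp
  obtain ⟨P, hP⟩ := exists_projection hK hKc hne
  have hPu : ∀ u v, v ∈ K → (∀ y ∈ K, inner ℝ (u - v) (y - v) ≤ 0) → P u = v := by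
    intro u v hv h
    have h1 := h _ (hP u).1
    have h2 := (hP u).2 v hv
    have h3 : inner ℝ (P u - v) (P u - v) ≤ 0 := by
      have e : inner ℝ (P u - v) (P u - v) =
          inner ℝ (u - v) (P u - v) + inner ℝ (u - P u) (v - P u) := by
        simp only [inner_sub_left, inner_sub_right]
        ring
      linarith
    rw [real_inner_self_eq_norm_sq, sq_nonpos_iff, norm_eq_zero] at h3
    exact sub_eq_zero.1 h3
  have hPL : LipschitzWith 1 P := by
    refine LipschitzWith.of_dist_le_mul fun u v => ?_
    rw [NNReal.coe_one, one_mul, dist_eq_norm, dist_eq_norm]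
    have h1 := (hP u).2 _ (hP v).1
    have h2 := (hP v).2 _ (hP u).1
    have h3 : ‖P u - P v‖ ^ 2 ≤ inner ℝ (u - v) (P u - P v) := by
      rw [← real_inner_self_eq_norm_sq]
      have e : inner ℝ (u - v) (P u - P v) - inner ℝ (P u - P v) (P u - P v) =
          -inner ℝ (u - P u) (P v - P u) - inner ℝ (v - P v) (P u - P v) := by
        simp only [inner_sub_left, inner_sub_right]
        ring
      linarith
    have h4 := h3.trans (real_inner_le_norm _ _)
    by_contra hcon
    rw [not_le] at hcon
    have h5 : 0 < ‖P u - P v‖ := (norm_nonneg _).trans_lt hcon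
    nlinarith
  have hnc : Continuous fun x : EuclideanSpace ℝ (Fin (k + 1)) => ‖WithLp.ofLp x‖ :=
    continuous_norm.comp (PiLp.continuous_ofLp 2 _)
  obtain ⟨R, hR⟩ : ∃ R, ∀ x ∈ K, ‖WithLp.ofLp x‖ ≤ R := by
    obtain ⟨x, hx, hmax⟩ := hK.exists_isMaxOn hne hnc.continuousOn
    exact ⟨_, fun y hy => hmax hy⟩
  set S : Set (EuclideanSpace ℝ (Fin (k + 1))) := {x | ‖WithLp.ofLp x‖ = R} with hS
  have hSc : IsCompact S := by
    refine Metric.isCompact_of_isClosed_isBounded (isClosed_eq hnc continuous_const) ?_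
    have := (PiLp.antilipschitzWith_ofLp 2 fun _ : Fin (k + 1) => ℝ).isBounded_preimage
      (Metric.isBounded_closedBall (x := (0 : Fin (k + 1) → ℝ)) (r := R))
    refine this.subset fun x hx => ?_
    rw [mem_preimage, mem_closedBall_zero_iff]
    exact le_of_eq hx
  -- All points of the ray from `P u` through `u` project to `P u`; the ray starts inside the cube
  -- and is unbounded, so it crosses the surface.
  have hout : ∀ u, u ∉ K → P u ∈ P '' S := by
    intro u hu
    have hv : u - P u ≠ 0 := fun h => hu (by rw [sub_eq_zero.1 h]; exact (hP u).1)
    have hcont : Continuous fun t : ℝ => ‖WithLp.ofLp (P u + t • (u - P u))‖ :=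
      hnc.comp (by fun_prop)
    have htend : Tendsto (fun t : ℝ => ‖WithLp.ofLp (P u + t • (u - P u))‖) atTop atTop := by
      have hv' : 0 < ‖WithLp.ofLp (u - P u)‖ := by
        rw [norm_pos_iff]
        intro h
        exact hv (WithLp.ofLp_injective 2 h)
      have h1 : Tendsto (fun t : ℝ => t * ‖WithLp.ofLp (u - P u)‖ - ‖WithLp.ofLp (P u)‖)
          atTop atTop :=
        tendsto_atTop_add_const_right _ _ (tendsto_id.atTop_mul_const hv')
      refine tendsto_atTop_mono' _ ?_ h1
      filter_upwards [eventually_ge_atTop 0] with t ht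
      rw [WithLp.ofLp_add, WithLp.ofLp_smul]
      have h2 := norm_sub_norm_le (t • WithLp.ofLp (u - P u)) (-WithLp.ofLp (P u))
      rw [norm_neg, sub_neg_eq_add, norm_smul, Real.norm_of_nonneg ht, add_comm (t • _)] at h2
      exact h2
    obtain ⟨t, ht, htR⟩ : ∃ t : ℝ, 0 ≤ t ∧ ‖WithLp.ofLp (P u + t • (u - P u))‖ = R := by
      obtain ⟨b, hb0, hb⟩ := ((eventually_ge_atTop 0).and (htend.eventually_ge_atTop R)).exists
      have h0 : ‖WithLp.ofLp (P u + (0 : ℝ) • (u - P u))‖ ≤ R := by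
        rw [zero_smul, add_zero]
        exact hR _ (hP u).1
      obtain ⟨t, ht, htR⟩ := intermediate_value_Icc hb0 hcont.continuousOn ⟨h0, hb⟩
      exact ⟨t, ht.1, htR⟩
    refine ⟨P u + t • (u - P u), htR, hPu _ _ (hP u).1 fun y hy => ?_⟩
    rw [add_sub_cancel_left, real_inner_smul_left]
    exact mul_nonpos_of_nonneg_of_nonpos ht ((hP u).2 y hy)
  have hsub : K \ interior K ⊆ P '' S := by
    rintro x ⟨hxK, hxi⟩
    have hPx : P x = x := hPu x x hxK fun y _ => by simp
    have hcl : x ∈ closure Kᶜ := by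
      rw [closure_compl]
      exact hxi
    -- A boundary point is a limit of outside points, whose projections lie in the compact set `P ''
    -- S`; by continuity so does its own projection, which is the point itself.
    rw [← (hSc.image hPL.continuous).isClosed.closure_eq, ← hPx]
    refine closure_mono ?_ (image_closure_subset_closure_image hPL.continuous
      (mem_image_of_mem P hcl))
    rintro _ ⟨u, hu, rfl⟩
    exact hout u hu
  refine (measure_mono hsub).trans_lt ((hPL.hausdorffMeasure_image_le k.cast_nonneg S).trans_lt ?_)
  exact ENNReal.mul_lt_top (ENNReal.rpow_lt_top_of_nonneg k.cast_nonneg ENNReal.coe_ne_top)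
    (hausdorffMeasure_cube_boundary_lt_top k R)

end Hausdorff

/-! ### Finitely many sites: polytopes and Laguerre cells. -/

section Finite

variable {E : Type*} [NormedAddCommGroup E] [InnerProductSpace ℝ E] {ι : Type*} [Finite ι]
  {z : ι → E} {α : ι → ℝ} {R : ℝ}

lemma isConvexPolytope_contactSet (hzi : Function.Injective z) (hz : ∀ i, ‖z i‖ ≤ R)
    (hα : BddAbove (range α)) (i : ι) : IsConvexPolytope (contactSet z α i) := by
  classical
  cases nonempty_fintype ι
  refine ⟨(Finset.univ.erase i).image fun j => (z j - z i, α i - α j), ?_, ?_⟩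
  · intro p hp
    obtain ⟨j, hj, rfl⟩ := Finset.mem_image.1 hp
    exact sub_ne_zero.2 fun h => (Finset.mem_erase.1 hj).1 (hzi h)
  · ext x
    rw [contactSet_eq_iInter hz hα]
    simp only [mem_iInter, mem_ofPred_eq, Finset.mem_image, Finset.mem_erase, Finset.mem_univ,
      and_true]
    constructor
    · rintro h _ ⟨j, -, rfl⟩
      exact h j
    · intro h j
      by_cases hj : j = i
      · subst hj
        simp
      · exact h _ ⟨j, hj, rfl⟩

lemma iUnion_contactSet [Nonempty ι] (hz : ∀ i, ‖z i‖ ≤ R) (hα : BddAbove (range α)) :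
    ⋃ i, contactSet z α i = univ := by
  refine eq_univ_of_forall fun x => ?_
  obtain ⟨i, hi⟩ := Finite.exists_max fun i => inner ℝ (z i) x + α i
  exact mem_iUnion.2 ⟨i, (mem_contactSet_iff hz hα).2 hi⟩

lemma isLaguerreTessellation_contactSet [Nonempty ι] (hzi : Function.Injective z)
    (hz : ∀ i, ‖z i‖ ≤ R) (hα : BddAbove (range α)) :
    IsLaguerreTessellation z (contactSet z α) := by
  refine ⟨?_, iUnion_contactSet hz hα, ?_⟩
  · obtain ⟨i₀, hi₀⟩ := Finite.exists_min fun i => ‖z i‖ ^ 2 + 2 * α i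
    -- With r_i² = |z_i|² + 2α_i − C the power distance is |x|² − 2(⟨z_i, x⟩ + α_i) + C, so its
    -- minimizers are the maximizers of the affine functions. Subtracting the minimum `C` keeps r_i²
    -- nonnegative.
    set C := ‖z i₀‖ ^ 2 + 2 * α i₀
    have hsq : ∀ i, Real.sqrt (‖z i‖ ^ 2 + 2 * α i - C) ^ 2 = ‖z i‖ ^ 2 + 2 * α i - C :=
      fun i => Real.sq_sqrt (sub_nonneg.2 (hi₀ i))
    refine ⟨fun i => Real.sqrt (‖z i‖ ^ 2 + 2 * α i - C), fun i => Real.sqrt_nonneg _,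
      fun i => ?_⟩
    ext x
    rw [mem_contactSet_iff hz hα, mem_ofPred_eq]
    refine forall_congr' fun j => ?_
    rw [hsq, hsq, norm_sub_sq_real, norm_sub_sq_real, real_inner_comm, real_inner_comm x (z i)]
    constructor <;> intro h <;> linarith
  · have h := pairwise_disjoint_openCell (M := univ) hzi hz hα
    simpa only [openCell, univ_inter] using h

end Finite

lemma hausdorffMeasure_diff_iUnion_openCell_lt_top {k : ℕ} {ι : Type*} [Finite ι] [Nonempty ι]
    {M : Set (EuclideanSpace ℝ (Fin (k + 1)))} {z : ι → EuclideanSpace ℝ (Fin (k + 1))}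
    {α : ι → ℝ} {R : ℝ} (hMc : IsCompact M) (hM : Convex ℝ M) (hz : ∀ i, ‖z i‖ ≤ R)
    (hα : BddAbove (range α)) :
    Measure.hausdorffMeasure (k : ℝ) (M \ ⋃ i, openCell M z α i) < ∞ := by
  have hsub : M \ ⋃ i, openCell M z α i ⊆
      ⋃ i, ((M ∩ contactSet z α i) \ interior (M ∩ contactSet z α i)) := by
    rintro x ⟨hx, hxU⟩
    have hx' : x ∈ ⋃ i, contactSet z α i := iUnion_contactSet hz hα ▸ mem_univ x
    obtain ⟨i, hi⟩ := mem_iUnion.1 hx'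
    exact mem_iUnion.2 ⟨i, ⟨hx, hi⟩, fun h => hxU (mem_iUnion.2 ⟨i, h⟩)⟩
  cases nonempty_fintype ι
  refine (measure_mono hsub).trans_lt ((measure_iUnion_le _).trans_lt ?_)
  rw [tsum_fintype]
  exact ENNReal.sum_lt_top.2 fun i _ => hausdorffMeasure_diff_interior_lt_top
    (hMc.inter_right (isClosed_contactSet hz hα i)) (hM.inter (convex_contactSet hz hα i))

/-! ### Weights with prescribed cell masses, by minimizing the dual functional. -/

section Existence

variable {E : Type*} [NormedAddCommGroup E] [InnerProductSpace ℝ E] [FiniteDimensional ℝ E]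
  [MeasurableSpace E] [BorelSpace E] {ι : Type*} [Nonempty ι]

/-- The dual functional of the transport problem from `m` to `∑ i, u i • δ_{z i}`. -/
noncomputable def dualCost (m : Measure E) (z : ι → E) (u α : ι → ℝ) : ℝ :=
  ∫ x, supAffine z α x ∂m - ∑' i, u i * α i

lemma bddAbove_of_abs_le {α : ι → ℝ} {C : ℝ} (h : ∀ i, |α i| ≤ C) : BddAbove (range α) :=
  ⟨C, by rintro _ ⟨i, rfl⟩; exact (abs_le.1 (h i)).2⟩

lemma summable_mul_of_abs_le {u α : ι → ℝ} {C : ℝ} (hu : Summable u) (hu0 : ∀ i, 0 ≤ u i)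
    (h : ∀ i, |α i| ≤ C) : Summable fun i => u i * α i := by
  refine Summable.of_norm_bounded (hu.mul_right C) fun i => ?_
  rw [norm_mul, Real.norm_of_nonneg (hu0 i), Real.norm_eq_abs]
  exact mul_le_mul_of_nonneg_left (h i) (hu0 i)

variable {m : Measure E} [IsProbabilityMeasure m] {M : Set E} {z : ι → E} {u : ι → ℝ} {R : ℝ}

lemma integrable_supAffine (hM : IsCompact M) (hm0 : m Mᶜ = 0) (hz : ∀ i, ‖z i‖ ≤ R) {α : ι → ℝ}
    (hα : BddAbove (range α)) : Integrable (supAffine z α) m :=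
  integrable_of_continuousOn hM hm0 (continuous_supAffine hz hα).continuousOn

/-- The integral and the weighted sum each move by at most ε; this gives continuity in the sup norm.
-/
lemma dualCost_le_add (hM : IsCompact M) (hm0 : m Mᶜ = 0) (hz : ∀ i, ‖z i‖ ≤ R)
    (hu : HasSum u 1) (hu0 : ∀ i, 0 ≤ u i) {α β : ι → ℝ} {C D ε : ℝ} (hα : ∀ i, |α i| ≤ C)
    (hβ : ∀ i, |β i| ≤ D) (h : ∀ i, |α i - β i| ≤ ε) :
    dualCost m z u α ≤ dualCost m z u β + 2 * ε := by
  have h1 : ∫ x, supAffine z α x ∂m ≤ ∫ x, (supAffine z β x + ε) ∂m := by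
    refine integral_mono (integrable_supAffine hM hm0 hz (bddAbove_of_abs_le hα))
      ((integrable_supAffine hM hm0 hz (bddAbove_of_abs_le hβ)).add (integrable_const ε))
      fun x => supAffine_le fun i => ?_
    have := le_supAffine hz (bddAbove_of_abs_le hβ) x i
    linarith [(abs_le.1 (h i)).2]
  rw [integral_add (integrable_supAffine hM hm0 hz (bddAbove_of_abs_le hβ)) (integrable_const ε),
    integral_const, probReal_univ, one_smul] at h1
  have h2 : ∑' i, u i * β i ≤ ∑' i, (u i * α i + u i * ε) := by
    refine (summable_mul_of_abs_le hu.summable hu0 hβ).tsum_le_tsum (fun i => ?_)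
      ((summable_mul_of_abs_le hu.summable hu0 hα).add (hu.summable.mul_right ε))
    rw [← mul_add]
    exact mul_le_mul_of_nonneg_left (by linarith [(abs_le.1 (h i)).1]) (hu0 i)
  rw [(summable_mul_of_abs_le hu.summable hu0 hα).tsum_add (hu.summable.mul_right ε),
    tsum_mul_right, hu.tsum_eq, one_mul] at h2
  unfold dualCost
  linarith

lemma dualCost_le_of_le (hM : IsCompact M) (hm0 : m Mᶜ = 0) (hz : ∀ i, ‖z i‖ ≤ R)
    (hu : HasSum u 1) (hu0 : ∀ i, 0 ≤ u i) {α β : ι → ℝ} {C D : ℝ} (hα : ∀ i, |α i| ≤ C)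
    (hβ : ∀ i, |β i| ≤ D) (h : ∀ i, α i ≤ β i)
    (hsup : ∀ x ∈ M, supAffine z β x ≤ supAffine z α x) :
    dualCost m z u β ≤ dualCost m z u α := by
  have h1 : ∫ x, supAffine z β x ∂m ≤ ∫ x, supAffine z α x ∂m := by
    refine integral_mono_ae (integrable_supAffine hM hm0 hz (bddAbove_of_abs_le hβ))
      (integrable_supAffine hM hm0 hz (bddAbove_of_abs_le hα)) ?_
    have hMm : ∀ᵐ x ∂m, x ∈ M := hm0
    filter_upwards [hMm] with x hx
    exact hsup x hx
  have h2 : ∑' i, u i * α i ≤ ∑' i, u i * β i :=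
    (summable_mul_of_abs_le hu.summable hu0 hα).tsum_le_tsum
      (fun i => mul_le_mul_of_nonneg_left (h i) (hu0 i))
      (summable_mul_of_abs_le hu.summable hu0 hβ)
  unfold dualCost
  linarith

lemma dualCost_sub_const (hM : IsCompact M) (hm0 : m Mᶜ = 0) (hz : ∀ i, ‖z i‖ ≤ R)
    (hu : HasSum u 1) (hu0 : ∀ i, 0 ≤ u i) {α : ι → ℝ} {C : ℝ} (hα : ∀ i, |α i| ≤ C) (c : ℝ) :
    dualCost m z u (fun i => α i - c) = dualCost m z u α := by
  have h1 : supAffine z (fun i => α i - c) = fun x => supAffine z α x - c := by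
    ext x
    rw [supAffine, supAffine, ciSup_sub (bddAbove_affine hz (bddAbove_of_abs_le hα) x)]
    simp only [add_sub_assoc]
  unfold dualCost
  rw [h1, integral_sub (integrable_supAffine hM hm0 hz (bddAbove_of_abs_le hα))
    (integrable_const c), integral_const, probReal_univ, one_smul]
  simp only [mul_sub]
  rw [(summable_mul_of_abs_le hu.summable hu0 hα).tsum_sub (hu.summable.mul_right c),
    tsum_mul_right, hu.tsum_eq]
  ring

/-- Any bounded weight vector can be replaced by the restriction of an `R`-Lipschitz function
bounded by `2R²` without increasing the dual functional. -/
lemma exists_lipschitz_dualCost_le (hM : IsCompact M) (hm0 : m Mᶜ = 0) (hR : ∀ x ∈ M, ‖x‖ ≤ R)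
    (hzM : ∀ i, z i ∈ M) (hu : HasSum u 1) (hu0 : ∀ i, 0 ≤ u i) {α : ι → ℝ} {C : ℝ}
    (hα : ∀ i, |α i| ≤ C) :
    ∃ a : E → ℝ, (∀ x y, |a x - a y| ≤ R * ‖x - y‖) ∧ (∀ x ∈ M, |a x| ≤ 2 * R ^ 2) ∧
      dualCost m z u (fun i => a (z i)) ≤ dualCost m z u α := by
  have hz : ∀ i, ‖z i‖ ≤ R := fun i => hR _ (hzM i)
  set x₀ := z (Classical.arbitrary ι)
  have hx₀ : x₀ ∈ M := hzM _
  have hR0 : 0 ≤ R := (norm_nonneg _).trans (hR _ hx₀)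
  have hαb := bddAbove_of_abs_le hα
  have hmin : ∀ y : E, ∃ x ∈ M, IsMinOn (fun x => supAffine z α x - inner ℝ y x) M x := fun y =>
    hM.exists_isMinOn ⟨x₀, hx₀⟩ ((continuous_supAffine hz hαb).sub
      (by fun_prop : Continuous fun x : E => inner ℝ y x)).continuousOn
  choose p hpM hp using hmin
  -- `b y` is the largest constant for which ⟨y, ·⟩ + b y stays below φ₁ on `M`. Hence b(z_i) ≥ α_i
  -- while the supremum on `M` does not grow, and the functional does not increase. Subtracting `b
  -- x₀` costs nothing, because the weights `u` sum to 1.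
  set b : E → ℝ := fun y => supAffine z α (p y) - inner ℝ y (p y) with hb
  have hble : ∀ y, ∀ x ∈ M, b y ≤ supAffine z α x - inner ℝ y x := fun y x hx => hp y hx
  have hsub : ∀ x y, b x - b y ≤ R * ‖x - y‖ := fun x y => by
    have h1 := hble x (p y) (hpM y)
    have h2 := real_inner_le_norm (y - x) (p y)
    have h3 := mul_le_mul_of_nonneg_left (hR _ (hpM y)) (norm_nonneg (y - x))
    rw [inner_sub_left] at h2
    rw [norm_sub_rev y x] at h2 h3
    have h4 : b y = supAffine z α (p y) - inner ℝ y (p y) := rfl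
    linarith
  have habs : ∀ x y, |b x - b y| ≤ R * ‖x - y‖ := fun x y =>
    abs_sub_le_iff.2 ⟨hsub x y, norm_sub_rev y x ▸ hsub y x⟩
  have hbound : ∀ x ∈ M, |b x - b x₀| ≤ 2 * R ^ 2 := fun x hx => by
    refine (habs x x₀).trans ?_
    have h1 : ‖x - x₀‖ ≤ R + R := (norm_sub_le _ _).trans (add_le_add (hR x hx) (hR _ hx₀))
    have h2 := mul_le_mul_of_nonneg_left h1 hR0
    linarith
  have hbz : ∀ i, |b (z i)| ≤ 2 * R ^ 2 + |b x₀| := fun i => by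
    have h1 := abs_add_le (b (z i) - b x₀) (b x₀)
    rw [sub_add_cancel] at h1
    linarith [hbound _ (hzM i)]
  refine ⟨fun x => b x - b x₀, fun x y => ?_, hbound, ?_⟩
  · simpa using habs x y
  · rw [dualCost_sub_const hM hm0 hz hu hu0 hbz]
    refine dualCost_le_of_le hM hm0 hz hu hu0 hα hbz (fun i => ?_)
      fun x hx => supAffine_le fun i => ?_
    · have := le_supAffine hz hαb (p (z i)) i
      simp only [hb]
      linarith
    · linarith [hble (z i) x hx]

/-- The dual functional attains its minimum over bounded weight vectors. -/
lemma exists_dualCost_min (hM : IsCompact M) (hm0 : m Mᶜ = 0) (hR : ∀ x ∈ M, ‖x‖ ≤ R)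
    (hzM : ∀ i, z i ∈ M) (hu : HasSum u 1) (hu0 : ∀ i, 0 ≤ u i) :
    ∃ α : ι → ℝ, (∃ C, ∀ i, |α i| ≤ C) ∧
      ∀ β : ι → ℝ, (∃ C, ∀ i, |β i| ≤ C) → dualCost m z u α ≤ dualCost m z u β := by
  have hz : ∀ i, ‖z i‖ ≤ R := fun i => hR _ (hzM i)
  have hR0 : 0 ≤ R := (norm_nonneg _).trans (hz (Classical.arbitrary ι))
  have : CompactSpace M := isCompact_iff_compactSpace.1 hM
  -- Minimization takes place over this compact family of functions on `M`, evaluated at the sites,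
  -- so that countably many weights are controlled at once.
  set A : Set (BoundedContinuousFunction M ℝ) :=
    {a | (∀ x y, |a x - a y| ≤ R * dist x y) ∧ ∀ x, |a x| ≤ 2 * R ^ 2} with hA
  have hcomp : IsCompact A := by
    refine BoundedContinuousFunction.arzela_ascoli₂ (Icc (-(2 * R ^ 2)) (2 * R ^ 2)) isCompact_Icc
      A ?_ (fun a x ha => abs_le.1 (ha.2 x)) ?_
    · have hev : ∀ x : M, Continuous fun a : BoundedContinuousFunction M ℝ => a x := fun x =>
        (BoundedContinuousFunction.lipschitz_eval_const x).continuous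
      simp only [hA, ofPred_and, ofPred_forall]
      refine IsClosed.inter (isClosed_iInter fun x => isClosed_iInter fun y => ?_)
        (isClosed_iInter fun x => ?_)
      · exact isClosed_le ((hev x).sub (hev y)).abs continuous_const
      · exact isClosed_le (hev x).abs continuous_const
    · refine Metric.equicontinuous_of_continuity_modulus (fun t => R * t) ?_ _ fun x y a => ?_
      · simpa using (continuous_const_mul R).tendsto 0
      · rw [Real.dist_eq]
        exact a.2.1 x y
  set G : BoundedContinuousFunction M ℝ → ℝ := fun a =>
    dualCost m z u fun i => a ⟨z i, hzM i⟩ with hG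
  have hbdd : ∀ (a : BoundedContinuousFunction M ℝ) (i : ι), |a ⟨z i, hzM i⟩| ≤ ‖a‖ :=
    fun a i => a.norm_coe_le_norm _
  have hGc : Continuous G := by
    refine (LipschitzWith.of_le_add_mul' 2 fun a b => ?_).continuous
    refine dualCost_le_add hM hm0 hz hu hu0 (hbdd a) (hbdd b) fun i => ?_
    rw [← Real.dist_eq]
    exact BoundedContinuousFunction.dist_coe_le_dist _
  obtain ⟨a, haA, hmin⟩ := hcomp.exists_isMinOn
    ⟨0, fun x y => by simpa using mul_nonneg hR0 dist_nonneg, fun x => by simp; positivity⟩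
    hGc.continuousOn
  refine ⟨fun i => a ⟨z i, hzM i⟩, ⟨_, hbdd a⟩, fun β ⟨C, hC⟩ => ?_⟩
  obtain ⟨b, hb1, hb2, hb3⟩ := exists_lipschitz_dualCost_le hM hm0 hR hzM hu hu0 hC
  refine le_trans ?_ hb3
  have hbc : Continuous b := (LipschitzWith.of_le_add_mul' R fun x y => by
    rw [dist_eq_norm]
    linarith [(abs_le.1 (hb1 x y)).2]).continuous
  have hmem : BoundedContinuousFunction.mkOfCompact
      ⟨fun x : M => b x, hbc.comp continuous_subtype_val⟩ ∈ A := by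
    refine ⟨fun x y => ?_, fun x => hb2 x x.2⟩
    have := hb1 x y
    rw [← dist_eq_norm] at this
    exact this
  exact hmin hmem

/-- Raising α_i by `t` lifts the supremum by at most `t`, and only on the set displayed, while the
weighted sum grows by u_i t. This one-sided comparison avoids differentiating the functional. -/
lemma le_measureReal_of_dualCost_min (hM : IsCompact M) (hm0 : m Mᶜ = 0) (hz : ∀ i, ‖z i‖ ≤ R)
    (hu : HasSum u 1) (hu0 : ∀ i, 0 ≤ u i) {α : ι → ℝ} {C : ℝ} (hα : ∀ i, |α i| ≤ C)
    (hmin : ∀ β : ι → ℝ, (∃ C, ∀ i, |β i| ≤ C) → dualCost m z u α ≤ dualCost m z u β)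
    (i : ι) {t : ℝ} (ht : 0 < t) :
    u i ≤ m.real {x | supAffine z α x ≤ inner ℝ (z i) x + α i + t} := by
  classical
  set V := {x | supAffine z α x ≤ inner ℝ (z i) x + α i + t} with hV
  have hαb := bddAbove_of_abs_le hα
  have hVm : MeasurableSet V :=
    (isClosed_le (continuous_supAffine hz hαb) (by fun_prop)).measurableSet
  set β : ι → ℝ := fun j => α j + if j = i then t else 0 with hβ
  have hβC : ∀ j, |β j| ≤ C + t := fun j => by
    refine (abs_add_le _ _).trans (add_le_add (hα j) ?_)
    split_ifs
    · exact (abs_of_pos ht).le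
    · simpa using ht.le
  have hsupm := integrable_supAffine hM hm0 hz hαb
  have hind : Integrable (V.indicator fun _ => t) m := (integrable_const t).indicator hVm
  have h1 : ∫ x, supAffine z β x ∂m ≤ ∫ x, (supAffine z α x + V.indicator (fun _ => t) x) ∂m := by
    refine integral_mono (integrable_supAffine hM hm0 hz (bddAbove_of_abs_le hβC))
      (hsupm.add hind) fun x => supAffine_le fun j => ?_
    have h2 := le_supAffine hz hαb x j
    by_cases hx : x ∈ V
    · rw [indicator_of_mem hx]
      simp only [hβ]
      split_ifs <;> linarith
    · rw [indicator_of_notMem hx]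
      simp only [hβ]
      split_ifs with hj
      · subst hj
        have h3 : ¬ supAffine z α x ≤ inner ℝ (z j) x + α j + t := hx
        linarith
      · linarith
  rw [integral_add hsupm hind, integral_indicator_const _ hVm, smul_eq_mul] at h1
  have h2 : ∑' j, u j * β j = ∑' j, u j * α j + u i * t := by
    have h3 : HasSum (fun j => u j * if j = i then t else 0) (u i * t) := by
      convert hasSum_single (f := fun j => u j * if j = i then t else 0) i ?_ using 1
      · simp
      · intro j hj
        simp [hj]
    simp only [hβ, mul_add]
    rw [(summable_mul_of_abs_le hu.summable hu0 hα).tsum_add h3.summable, h3.tsum_eq]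
  have h3 := hmin β ⟨_, hβC⟩
  unfold dualCost at h3
  rw [h2] at h3
  exact le_of_mul_le_mul_right (by linarith) ht

variable {vol : Measure E} [vol.IsAddHaarMeasure] [Countable ι]

/-- Weights for which the cells have prescribed masses exist. -/
theorem exists_hasCellMasses (hM : IsCompact M) (hMc : Convex ℝ M) (hm : m ≪ vol)
    (hm0 : m Mᶜ = 0) (hzi : Function.Injective z) (hzM : ∀ i, z i ∈ M) {w : ι → ℝ≥0∞}
    (hw : ∑' i, w i = 1) : ∃ α, HasCellMasses vol M m z w α := by
  obtain ⟨R, hR⟩ := hM.isBounded.exists_norm_le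
  have hz : ∀ i, ‖z i‖ ≤ R := fun i => hR _ (hzM i)
  have hwt : ∀ i, w i ≠ ∞ := ENNReal.ne_top_of_tsum_ne_top (by simp [hw])
  have hu : HasSum (fun i => (w i).toReal) 1 := by
    have h1 := ENNReal.hasSum_toReal (f := w) (by simp [hw])
    rwa [← ENNReal.tsum_toReal_eq hwt, hw, ENNReal.toReal_one] at h1
  have hu0 : ∀ i, 0 ≤ (w i).toReal := fun i => ENNReal.toReal_nonneg
  obtain ⟨α, ⟨C, hα⟩, hmin⟩ := exists_dualCost_min (m := m) hM hm0 hR hzM hu hu0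
  have hαb := bddAbove_of_abs_le hα
  have hle : ∀ i, w i ≤ m (contactSet z α i) := by
    intro i
    set V : ℕ → Set E := fun k => {x | supAffine z α x ≤ inner ℝ (z i) x + α i + 1 / ((k : ℝ) + 1)}
      with hV
    have hVm : ∀ k, MeasurableSet (V k) := fun k =>
      (isClosed_le (continuous_supAffine hz hαb) (by fun_prop)).measurableSet
    have hanti : Antitone V := fun k l hkl x hx => by
      have h1 : supAffine z α x ≤ inner ℝ (z i) x + α i + 1 / ((l : ℝ) + 1) := hx
      have h2 := Nat.one_div_le_one_div (α := ℝ) hkl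
      change supAffine z α x ≤ inner ℝ (z i) x + α i + 1 / ((k : ℝ) + 1)
      linarith
    have hinter : ⋂ k, V k = contactSet z α i := by
      ext x
      rw [mem_iInter]
      constructor
      · intro h
        refine le_antisymm ?_ (le_supAffine hz hαb x i)
        have h1 : Tendsto (fun k : ℕ => inner ℝ (z i) x + α i + 1 / ((k : ℝ) + 1)) atTop
            (𝓝 (inner ℝ (z i) x + α i + 0)) :=
          tendsto_const_nhds.add tendsto_one_div_add_atTop_nhds_zero_nat
        rw [add_zero] at h1
        exact ge_of_tendsto' h1 h
      · intro h k
        have h1 : supAffine z α x = inner ℝ (z i) x + α i := h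
        have h2 := Nat.one_div_pos_of_nat (α := ℝ) (n := k)
        change supAffine z α x ≤ _
        linarith
    have htend := tendsto_measure_iInter_atTop (μ := m) (fun k => (hVm k).nullMeasurableSet) hanti
      ⟨0, measure_ne_top m _⟩
    rw [hinter] at htend
    refine ge_of_tendsto' htend fun k => ?_
    rw [Function.comp_apply, ← ENNReal.toReal_le_toReal (hwt i) (measure_ne_top m _)]
    exact le_measureReal_of_dualCost_min hM hm0 hz hu hu0 hα hmin i Nat.one_div_pos_of_nat
  refine ⟨α, hM, hMc, hm, hm0, hzi, hzM, hw, hαb, fun i => ?_⟩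
  -- Every cell has at least its prescribed mass. One strict excess would make the total mass of the
  -- disjoint open cells exceed 1.
  by_contra hne
  have hlt : w i < m (contactSet z α i) := lt_of_le_of_ne (hle i) (Ne.symm hne)
  have h1 := ENNReal.tsum_lt_tsum (by simp [hw]) hle hlt
  have h2 : ∑' i, m (contactSet z α i) = m (⋃ i, openCell M z α i) := by
    rw [measure_iUnion (pairwise_disjoint_openCell hzi hz hαb)
      fun i => (isOpen_openCell i).measurableSet]
    exact tsum_congr fun i => (measure_openCell_eq hM.isClosed hMc hm hm0 hz hαb i).symm
  rw [hw, h2] at h1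
  exact absurd prob_le_one (not_le.2 h1)

end Existence

end ConjugationMap

/-! ### Assembly. -/

theorem theorem4p2 {n : ℕ} (hn : 1 ≤ n) (M : Set (EuclideanSpace ℝ (Fin n)))
    (hMcompact : IsCompact M) (hMconvex : Convex ℝ M)
    (m : Measure (EuclideanSpace ℝ (Fin n))) [IsProbabilityMeasure m]
    (hm_ac : m ≪ volume) (hm_supp : m.support = M)
    {ι : Type*} [Countable ι] (z : ι → EuclideanSpace ℝ (Fin n)) (hz : Function.Injective z)
    (hzM : ∀ i, z i ∈ M) (w : ι → ℝ≥0∞) (hw : ∑' i, w i = 1) :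
    -- the optimal transport map, the conjugate measure and suitable numbers `α i` exist
    (∃ g, ConjugationMap.IsOptimalTransportMap M m (ConjugationMap.discreteMeasure z w) g) ∧
    (∃ ν, ConjugationMap.IsConjugateMeasure M m (ConjugationMap.discreteMeasure z w) ν) ∧
    (∃ α : ι → ℝ, BddAbove (Set.range α) ∧ ∀ i, m (ConjugationMap.contactSet z α i) = w i) ∧
    -- and every such choice of the numbers `α i` has the asserted properties
    ∀ α : ι → ℝ, BddAbove (Set.range α) → (∀ i, m (ConjugationMap.contactSet z α i) = w i) →
      -- the sets `U i`
      (∀ i, IsOpen (ConjugationMap.openCell M z α i) ∧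
        Convex ℝ (ConjugationMap.openCell M z α i) ∧
        ConjugationMap.openCell M z α i ⊆ M ∧
        m (ConjugationMap.openCell M z α i) = w i) ∧
      (Pairwise fun i j =>
        Disjoint (ConjugationMap.openCell M z α i) (ConjugationMap.openCell M z α j)) ∧
      -- `φ₁` is the potential of the optimal transport map, whose value on `U i` is `z i`
      ConjugationMap.IsDSqConvex M (fun x => ConjugationMap.supAffine z α x - ‖x‖ ^ 2 / 2) ∧
      (∀ i, ∀ x ∈ ConjugationMap.openCell M z α i,
        HasGradientAt (ConjugationMap.supAffine z α) (z i) x) ∧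
      (∀ g, ConjugationMap.IsOptimalTransportMap M m (ConjugationMap.discreteMeasure z w) g →
        (∀ᵐ x ∂m, HasGradientAt (ConjugationMap.supAffine z α) (g x) x) ∧
        ∀ i, ∀ᵐ x ∂m, x ∈ ConjugationMap.openCell M z α i → g x = z i) ∧
      -- the compact `m`-null set that carries the conjugate measure
      IsCompact (M \ ⋃ i, ConjugationMap.openCell M z α i) ∧
      m (M \ ⋃ i, ConjugationMap.openCell M z α i) = 0 ∧
      (∀ ν, ConjugationMap.IsConjugateMeasure M m (ConjugationMap.discreteMeasure z w) ν →
        IsProbabilityMeasure ν ∧ ν (M \ ⋃ i, ConjugationMap.openCell M z α i)ᶜ = 0) ∧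
      -- finitely many atoms
      (Finite ι →
        (∀ i, ConjugationMap.IsConvexPolytope (ConjugationMap.contactSet z α i)) ∧
        ConjugationMap.IsLaguerreTessellation z (ConjugationMap.contactSet z α) ∧
        (∀ i, w i ≠ 0 → (interior (ConjugationMap.contactSet z α i)).Nonempty) ∧
        Measure.hausdorffMeasure ((n : ℝ) - 1)
          (M \ ⋃ i, ConjugationMap.openCell M z α i) < ∞) := by
  have hm0 : m Mᶜ = 0 := hm_supp ▸ Measure.measure_compl_support
  have : Nonempty ι := by
    by_contra hne
    rw [not_nonempty_iff] at hne
    simp at hw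
  -- Excludes dimension zero, so that single points, and hence the set of sites, are Lebesgue-null,
  -- as `ae_conj_mem` needs.
  have : Nonempty (Fin n) := ⟨⟨0, hn⟩⟩
  obtain ⟨α₀, h₀⟩ := ConjugationMap.exists_hasCellMasses hMcompact hMconvex hm_ac hm0 hz hzM hw
  refine ⟨h₀.exists_isOptimalTransportMap.imp fun _ hg => hg.1, h₀.exists_isConjugateMeasure,
    ⟨α₀, h₀.bddAbove, h₀.measure_contactSet⟩, fun α hα hmass => ?_⟩
  have h : ConjugationMap.HasCellMasses volume M m z w α :=
    ⟨hMcompact, hMconvex, hm_ac, hm0, hz, hzM, hw, hα, hmass⟩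
  obtain ⟨R, hR, hzR⟩ := h.exists_bound
  refine ⟨fun i => ⟨ConjugationMap.isOpen_openCell i,
      ConjugationMap.convex_openCell hMconvex hzR hα i, ConjugationMap.openCell_subset i,
      h.measure_openCell i⟩, h.pairwise_disjoint,
    ConjugationMap.isDSqConvex_supAffine hMcompact hzM hα,
    fun i x hx => ConjugationMap.hasGradientAt_supAffine hx, fun g hg => ⟨?_, fun i => ?_⟩,
    hMcompact.diff (isOpen_iUnion fun i => ConjugationMap.isOpen_openCell i), ?_,
    fun ν hν => ?_, fun hfin => ?_⟩
  · filter_upwards [h.ae_eq_of_isOptimalTransportMap hg, h.ae_mem_iUnion] with x hx hxU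
    obtain ⟨i, hi⟩ := Set.mem_iUnion.1 hxU
    rw [hx i hi]
    exact ConjugationMap.hasGradientAt_supAffine hi
  · filter_upwards [h.ae_eq_of_isOptimalTransportMap hg] with x hx
    exact hx i
  · exact measure_mono_null (fun x hx => hx.2) h.ae_mem_iUnion
  · obtain ⟨φ, hφ, hmap, rfl⟩ := hν
    have hmeas := ConjugationMap.measurable_expGrad (ConjugationMap.conj M φ)
    refine ⟨Measure.isProbabilityMeasure_map hmeas.aemeasurable, ?_⟩
    rw [Measure.map_apply hmeas (hMcompact.diff (isOpen_iUnion fun i =>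
      ConjugationMap.isOpen_openCell i)).measurableSet.compl]
    exact h.ae_conj_mem hm_supp hφ hmap
  · refine ⟨ConjugationMap.isConvexPolytope_contactSet hz hzR hα,
      ConjugationMap.isLaguerreTessellation_contactSet hz hzR hα, fun i hi => ?_, ?_⟩
    · rw [← h.measure_openCell i] at hi
      exact (nonempty_of_measure_ne_zero hi).mono (interior_mono Set.inter_subset_right)
    · obtain ⟨k, rfl⟩ := Nat.exists_eq_add_of_le' hn
      rw [Nat.cast_add, Nat.cast_one, add_sub_cancel_right]
      exact ConjugationMap.hausdorffMeasure_diff_iUnion_openCell_lt_top hMcompact hMconvex hzR hα
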